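/- **Setting.** Let $M$ be a connected, Hausdorff, second-countable smooth $n$-manifold, let $2\le q<n$, and let $\mathcal F$ be a codimension $q$ smooth foliation of $M$, given by an open cover $\{U_i\}$ of $M$, submersions $\pi_i:U_i\to\mathbb R^q$ and diffeomorphisms $\gamma_{ij}:\pi_j(U_i\cap U_j)\to\pi_i(U_i\cap U_j)$ with $\gamma_{ij}\circ\pi_j=\pi_i$ on $U_i\cap U_j$; its plaques are the connected components of the fibres of the $\pi_i$, and two points lie on the same leaf when they are joined by a finite chain of plaques. The leaf space $M/\mathcal F$ carries the quotient topology, and $T_x\mathcal F=\ker d(\pi_i)_x$ is the tangent space of the leaf through $x\in U_i$. Let $g_\intercal$ be a Lorentzian transverse metric for $\mathcal F$: a smooth symmetric $(0,2)$-tensor field on $M$ which vanishes when one argument is tangent to $\mathcal F$, satisfies $\mathcal L_Vg_\intercal=0$ for all vector fields $V$ tangent to $\mathcal F$, and induces on each normal space $T_xM/T_x\mathcal F$ a nondegenerate form of index $1$. A vector $v\in T_xM$ is transversely timelike if $g_\intercal(v,v)<0$, and transversely causal if it is transversely timelike or if $v\notin T_x\mathcal F$ and $g_\intercal(v,v)=0$.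 A timewedge at $x$ is a connected component of the set of transversely timelike vectors in $T_xM$. Suppose a transverse time-orientation is given: a choice at each $x\in M$ of a timewedge $\tau^\intercal_+(x)$ (the future one) such that near every point there is a smooth vector field with values in these timewedges. A transversely causal vector at $x$ is future-directed if it lies in the closure of $\tau^\intercal_+(x)$. A piecewise smooth curve $\alpha:[a,b]\to M$ ($a<b$) is future-directed transversely timelike [causal] if all its velocity vectors (both one-sided ones at break points) are transversely timelike [causal] and future-directed. For leaves $L,L'$ write $L\ll L'$ [resp. $L<L'$] if there is a future-directed transversely timelike [resp. transversely causal] piecewise smooth curve $\alpha:[a,b]\to M$, $a<b$, with $\alpha(a)\in L$ and $\alpha(b)\in L'$, and write $L\le L'$ if $L<L'$ or $L=L'$. For a set $\mathcal A$ of leaves let $$I^+(\mathcal A)=\{L':\exists L\in\mathcal A,\ L\ll L'\},\qquad I^-(\mathcal A)=\{L':\exists L\in\mathcal A,\ L'\ll L\},$$ $$J^+(\mathcal A)=\{L':\exists L\in\mathcal A,\ L\le L'\},\qquad J^-(\mathcal A)=\{L':\exists L\in\mathcal A,\ L'\le L\}.$$ **Theorem 4.23.** The following hold. (a) Both $\ll$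 and $<$ are transitive. They are also dense: if $L\ll L'$, there is a leaf $L''$ with $L\ll L''\ll L'$; if $L<L'$, there is a leaf $L''$ with $L<L''<L'$. Moreover $I^\pm(\{L\})$ and $J^\pm(\{L\})$ are non-empty for every leaf $L$. (b) The relation $\ll$ is open in $M/\mathcal F\times M/\mathcal F$ with the product topology. (c) (Push-up) If $L_1\ll L_2$ and $L_2\le L_3$, or $L_1\le L_2$ and $L_2\ll L_3$, then $L_1\ll L_3$. (d) For every set $\mathcal A$ of leaves, with respect to the quotient topology on $M/\mathcal F$, $$\overline{J^\pm(\mathcal A)}=\overline{I^\pm(\mathcal A)},\qquad \operatorname{int}J^\pm(\mathcal A)=I^\pm(\mathcal A),$$ and in particular $\partial J^\pm(\mathcal A)=\partial I^\pm(\mathcal A)$. -/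

import Mathlib

open Set Topology Bundle
open scoped Manifold ContDiff

noncomputable section

namespace LorentzFoliation

variable {ι : Type*} {n q : ℕ} {M : Type*} [TopologicalSpace M]
  [ChartedSpace (EuclideanSpace ℝ (Fin n)) M] [IsManifold (𝓡 n) ∞ M]

/-- A codimension `q` smooth foliation of the `n`-manifold `M`, given by a Haefliger cocycle: an
open cover `U i` of `M`, submersions `proj i : U i → ℝ^q` (the values of `proj i` off `U i` are
irrelevant) and smooth transition maps `γ i j : proj j (U i ∩ U j) → proj i (U i ∩ U j)` with
`γ i j ∘ proj j = proj i` on `U i ∩ U j`. The last identity makes `γ j i` the inverse of `γ i j`, so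
that the transition maps are diffeomorphisms. -/
structure Foliation (ι : Type*) (n q : ℕ) (M : Type*) [TopologicalSpace M]
    [ChartedSpace (EuclideanSpace ℝ (Fin n)) M] [IsManifold (𝓡 n) ∞ M] where
  U : ι → Set M
  proj : ι → M → EuclideanSpace ℝ (Fin q)
  γ : ι → ι → EuclideanSpace ℝ (Fin q) → EuclideanSpace ℝ (Fin q)
  isOpen_U : ∀ i, IsOpen (U i)
  cover : ∀ x, ∃ i, x ∈ U i
  submersion : ∀ i, ∀ x ∈ U i, Manifold.IsSubmersionAt (𝓡 n) (𝓡 q) ∞ (proj i) x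
  smooth_γ : ∀ i j, ContDiffOn ℝ ∞ (γ i j) (proj j '' (U i ∩ U j))
  γ_comp : ∀ i j, ∀ x ∈ U i ∩ U j, γ i j (proj j x) = proj i x

namespace Foliation

variable (F : Foliation ι n q M)

/-- `x` and `y` lie on a common plaque, i.e. on the same connected component of a fibre of some
`proj i : U i → ℝ^q`. -/
def SamePlaque (x y : M) : Prop :=
  ∃ i, x ∈ F.U i ∧ y ∈ connectedComponentIn (F.U i ∩ F.proj i ⁻¹' {F.proj i x}) x

/-- The partition of `M` into leaves: two points lie on the same leaf when they are joined by a
finite chain of plaques. -/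
def leafSetoid : Setoid M := Relation.EqvGen.setoid F.SamePlaque

/-- The leaf space `M / F`; as a quotient of `M` it carries the quotient topology. -/
abbrev LeafSpace : Type _ := Quotient F.leafSetoid

/-- The leaf through `x`, as a point of the leaf space. -/
def leaf (x : M) : F.LeafSpace := Quotient.mk F.leafSetoid x

/-- The tangent space at `x` of the leaf through `x`: the kernel of `d(proj i)ₓ` for the `i` with
`x ∈ U i` (by the cocycle condition, the same subspace for all of them). -/
def tangent (x : M) : Submodule ℝ (TangentSpace (𝓡 n) x) :=
  ⨅ (i : ι) (_ : x ∈ F.U i), LinearMap.ker (mvfderiv (𝓡 n) (F.proj i) x).toLinearMap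

end Foliation

/-- The vector field `X` is defined and smooth on the set `U`. -/
def SmoothFieldOn (X : ∀ x : M, TangentSpace (𝓡 n) x) (U : Set M) : Prop :=
  ContMDiffOn (𝓡 n) (𝓡 n).tangent ∞ (fun x => (⟨x, X x⟩ : TangentBundle (𝓡 n) M)) U

/-- The value at `x` of `(𝓛_V ξ)(X, Y) = V (ξ (X, Y)) - ξ ([V, X], Y) - ξ (X, [V, Y])`, the Lie
derivative of the `(0,2)`-tensor field `ξ`. -/
def lieDeriv (ξ : ∀ x : M, TangentSpace (𝓡 n) x →L[ℝ] TangentSpace (𝓡 n) x →L[ℝ] ℝ)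
    (V X Y : ∀ x : M, TangentSpace (𝓡 n) x) (x : M) : ℝ :=
  mvfderiv (𝓡 n) (fun y => ξ y (X y) (Y y)) x (V x)
    - ξ x (VectorField.mlieBracket (𝓡 n) V X x) (Y x)
    - ξ x (X x) (VectorField.mlieBracket (𝓡 n) V Y x)

/-- A `(0,2)`-tensor field is `F`-basic when it vanishes as soon as one argument is tangent to the
leaves and its Lie derivative along every (locally defined) vector field tangent to the leaves is
zero. -/
structure IsBasic (F : Foliation ι n q M)
    (ξ : ∀ x : M, TangentSpace (𝓡 n) x →L[ℝ] TangentSpace (𝓡 n) x →L[ℝ] ℝ) : Prop where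
  left : ∀ x, ∀ v ∈ F.tangent x, ∀ w, ξ x v w = 0
  right : ∀ x, ∀ v, ∀ w ∈ F.tangent x, ξ x v w = 0
  lie : ∀ U : Set M, IsOpen U → ∀ V X Y : (∀ x : M, TangentSpace (𝓡 n) x),
    SmoothFieldOn V U → SmoothFieldOn X U → SmoothFieldOn Y U → (∀ x ∈ U, V x ∈ F.tangent x) →
    ∀ x ∈ U, lieDeriv ξ V X Y x = 0

/-- A Lorentzian transverse metric for `F`: a smooth symmetric `F`-basic `(0,2)`-tensor field that
induces on each normal space `TₓM / TₓF` a nondegenerate form (equivalently, its radical in `TₓM`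
is no larger than `TₓF`) of index one (the index of the induced form is that of the form on `TₓM`,
a negative definite subspace being transverse to the radical). -/
structure TransverseLorentzMetric (F : Foliation ι n q M) where
  g : ∀ x : M, TangentSpace (𝓡 n) x →L[ℝ] TangentSpace (𝓡 n) x →L[ℝ] ℝ
  smooth : ContMDiff (𝓡 n)
    ((𝓡 n).prod 𝓘(ℝ, EuclideanSpace ℝ (Fin n) →L[ℝ] EuclideanSpace ℝ (Fin n) →L[ℝ] ℝ)) ∞
    (fun x => TotalSpace.mk'
      (EuclideanSpace ℝ (Fin n) →L[ℝ] EuclideanSpace ℝ (Fin n) →L[ℝ] ℝ)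
      (E := fun x : M => TangentSpace (𝓡 n) x →L[ℝ] TangentSpace (𝓡 n) x →L[ℝ] ℝ) x (g x))
  symm : ∀ x v w, g x v w = g x w v
  basic : IsBasic F g
  nondegenerate : ∀ x v, (∀ w, g x v w = 0) → v ∈ F.tangent x
  index_one : ∀ x,
    sigNeg (LinearMap.BilinMap.toQuadraticMap (g x).toBilinForm) = 1

namespace TransverseLorentzMetric

variable {F : Foliation ι n q M} (G : TransverseLorentzMetric F)

/-- The set of transversely timelike vectors at `x`. -/
def timelike (x : M) : Set (TangentSpace (𝓡 n) x) := {v | G.g x v v < 0}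

/-- The set of transversely lightlike vectors at `x`. -/
def lightlike (x : M) : Set (TangentSpace (𝓡 n) x) := {v | v ∉ F.tangent x ∧ G.g x v v = 0}

/-- The set of transversely causal vectors at `x`. -/
def causal (x : M) : Set (TangentSpace (𝓡 n) x) := G.timelike x ∪ G.lightlike x

/-- A timewedge at `x`: a connected component of the set of transversely timelike vectors. -/
def IsTimewedge (x : M) (W : Set (TangentSpace (𝓡 n) x)) : Prop :=
  ∃ v ∈ G.timelike x, W = connectedComponentIn (G.timelike x) v

end TransverseLorentzMetric

/-- A transverse time-orientation: a choice of a timewedge `wedge x` (the future one) at every point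
that varies smoothly with the point. -/
structure TimeOrientation {F : Foliation ι n q M} (G : TransverseLorentzMetric F) where
  wedge : ∀ x : M, Set (TangentSpace (𝓡 n) x)
  isTimewedge : ∀ x, G.IsTimewedge x (wedge x)
  smooth : ∀ x : M, ∃ U : Set M, IsOpen U ∧ x ∈ U ∧ ∃ X : (∀ y : M, TangentSpace (𝓡 n) y),
    SmoothFieldOn X U ∧ ∀ y ∈ U, X y ∈ wedge y

/-- `α` restricts to a piecewise smooth curve on `[a, b]` all of whose velocity vectors (at a break
point, both one-sided ones) lie in the cone field `C`. -/
def IsPiecewiseSmoothIn (C : ∀ x : M, Set (TangentSpace (𝓡 n) x)) (α : ℝ → M) (a b : ℝ) : Prop :=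
  ∃ (k : ℕ) (t : Fin (k + 1) → ℝ), StrictMono t ∧ t 0 = a ∧ t (Fin.last k) = b ∧
    ∀ i : Fin k,
      ContMDiffOn 𝓘(ℝ, ℝ) (𝓡 n) ∞ α (Icc (t i.castSucc) (t i.succ)) ∧
      ∀ s ∈ Icc (t i.castSucc) (t i.succ),
        (mfderivWithin 𝓘(ℝ, ℝ) (𝓡 n) α (Icc (t i.castSucc) (t i.succ)) s (1 : ℝ) :
          TangentSpace (𝓡 n) (α s)) ∈ C (α s)

namespace TimeOrientation

variable {F : Foliation ι n q M} {G : TransverseLorentzMetric F} (T : TimeOrientation G)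

/-- The future causal wedge at `x`: the transversely causal vectors that lie in the future timewedge
or on its boundary. -/
def causalWedge (x : M) : Set (TangentSpace (𝓡 n) x) := G.causal x ∩ closure (T.wedge x)

/-- The leaf space chronological relation `L ≪ L'`. -/
def Chron (L L' : F.LeafSpace) : Prop :=
  ∃ (α : ℝ → M) (a b : ℝ), a < b ∧ IsPiecewiseSmoothIn T.wedge α a b ∧
    F.leaf (α a) = L ∧ F.leaf (α b) = L'

/-- The leaf space causality relation `L < L'`. -/
def CausalLT (L L' : F.LeafSpace) : Prop :=
  ∃ (α : ℝ → M) (a b : ℝ), a < b ∧ IsPiecewiseSmoothIn T.causalWedge α a b ∧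
    F.leaf (α a) = L ∧ F.leaf (α b) = L'

/-- `L ≤ L'`: either `L < L'` or `L = L'`. -/
def CausalLE (L L' : F.LeafSpace) : Prop := T.CausalLT L L' ∨ L = L'

/-- The leaf space chronological future of a set of leaves. -/
def chronFuture (A : Set F.LeafSpace) : Set F.LeafSpace := {L' | ∃ L ∈ A, T.Chron L L'}

/-- The leaf space chronological past of a set of leaves. -/
def chronPast (A : Set F.LeafSpace) : Set F.LeafSpace := {L' | ∃ L ∈ A, T.Chron L' L}

/-- The leaf space causal future of a set of leaves. -/
def causalFuture (A : Set F.LeafSpace) : Set F.LeafSpace := {L' | ∃ L ∈ A, T.CausalLE L L'}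

/-- The leaf space causal past of a set of leaves. -/
def causalPast (A : Set F.LeafSpace) : Set F.LeafSpace := {L' | ∃ L ∈ A, T.CausalLE L' L}

end TimeOrientation

end LorentzFoliation

end

/-! The chronological and causal relations on leaves reduce to reachability between points by finite
chains of smooth segments with velocities in a cone field (`Seg`, `Reach`), once it is known that
reachability does not depend on the chosen points of the two leaves. All the geometry needed is
local and is packaged in `LocalModel`. Around every point there is a chart in which the submersion
becomes a linear projection `P`. The coordinate form `h` of the transverse metric is constant along
the fibres of `P`, because its Lie derivative along the leaves vanishes, and it kills their
directions. The future wedges become `h v v < 0` or `h v v ≤ 0` together with `h v ξ < 0`, for one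
constant timelike vector `ξ`.

Three local deformations of curves then suffice. A vector of `ker P` can be added gradually near the
end of a curve without leaving the cone, so the end point slides along a plaque; connectedness of
plaques extends this to whole leaves (`leaf_rel_of_local`, `chron_leaf_iff`, `causalLT_leaf_iff`).
The timelike cone is open, so the last piece of a timelike curve can be redirected to any nearby
point (`isOpen_setOf_reach`). Finally, a causal curve tilted in the direction of `ξ` becomes
timelike with the same end and a nearby start (`exists_seg_of_causal`); with openness this gives
push-up by looking at the first parameter where the chronological future would be left
(`reach_of_seg`).

Time reversal of the cone fields turns each statement about ends into one about starts. Density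
comes from cutting a segment in two, openness of the relation from density and openness of futures
and pasts, and the closure and interior formulas from the order-theoretic
`closure_interior_frontier_future`. -/

noncomputable section

namespace LorentzFoliation

/-! ### Linear algebra of symmetric forms of index one. -/

section LorentzForm

variable {V : Type*} [AddCommGroup V] [Module ℝ V] [Module.Finite ℝ V] {B : LinearMap.BilinForm ℝ V}

/-- A form of index one has no orthogonal pair of timelike vectors. -/
theorem timelike_not_orthogonal (hB : ∀ v w, B v w = B w v)
    (hi : sigNeg (LinearMap.BilinMap.toQuadraticMap B) = 1) {X Y : V}
    (hX : B X X < 0) (hY : B Y Y < 0) : B X Y ≠ 0 := by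
  intro h0
  have hval : ∀ a b : ℝ, B (a • X + b • Y) (a • X + b • Y) = a ^ 2 * B X X + b ^ 2 * B Y Y := by
    intro a b
    have := hB Y X
    simp only [map_add, map_smul, LinearMap.add_apply, LinearMap.smul_apply, smul_eq_mul]
    rw [this, h0]; ring
  have hneg : ∀ a b : ℝ, (a ≠ 0 ∨ b ≠ 0) → a ^ 2 * B X X + b ^ 2 * B Y Y < 0 := by
    intro a b hab
    rcases hab with h | h
    · have : 0 < a ^ 2 := by positivity
      nlinarith [sq_nonneg b]
    · have : 0 < b ^ 2 := by positivity
      nlinarith [sq_nonneg a]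
  have hli : LinearIndependent ℝ ![X, Y] := by
    rw [LinearIndependent.pair_iff]
    intro a b hab
    by_contra hne
    have h1 := hneg a b (by tauto)
    rw [← hval, hab] at h1
    simp at h1
  -- An orthogonal timelike pair would span a negative definite plane, contradicting index one.
  have hfr : Module.finrank ℝ (Submodule.span ℝ (Set.range ![X, Y])) = 2 := by
    simpa using finrank_span_eq_card hli
  have hle : Module.finrank ℝ (Submodule.span ℝ (Set.range ![X, Y])) ≤
      sigNeg (LinearMap.BilinMap.toQuadraticMap B) := by
    apply le_sigNeg_of_negDef
    rintro ⟨v, hv⟩ hv0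
    have hv' : v ∈ Submodule.span ℝ {X, Y} := by
      simpa only [Matrix.range_cons, Matrix.range_empty, union_empty, singleton_union] using hv
    obtain ⟨a, b, rfl⟩ := Submodule.mem_span_pair.1 hv'
    have hab : a ≠ 0 ∨ b ≠ 0 := by
      by_contra hcon
      push Not at hcon
      exact hv0 (by simp [hcon.1, hcon.2])
    have := hneg a b hab
    rw [← hval] at this
    change 0 < -(B (a • X + b • Y) (a • X + b • Y))
    linarith
  omega

/-- A null vector orthogonal to a timelike one lies in the radical. -/
theorem null_orthogonal_timelike (hB : ∀ v w, B v w = B w v)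
    (hi : sigNeg (LinearMap.BilinMap.toQuadraticMap B) = 1) {X Y : V}
    (hX : B X X < 0) (hY : B Y Y = 0) (hXY : B X Y = 0) (w : V) : B Y w = 0 := by
  by_contra hw
  have hYX : B Y X = 0 := by rw [hB, hXY]
  -- Subtracting `a • X` makes `w` orthogonal to `X`. Adding `s • Y` keeps this orthogonality and,
  -- since `Y` is null, changes the square linearly in `s`; the value of `s` makes the square `-1`,
  -- giving a forbidden orthogonal timelike pair.
  set a := B X w / B X X with ha
  have haX : a * B X X = B X w := div_mul_cancel₀ _ hX.ne
  set s := (-1 - B (w - a • X) (w - a • X)) / (2 * B Y w) with hs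
  have hsY : 2 * s * B Y w = -1 - B (w - a • X) (w - a • X) := by
    rw [hs]; field_simp
  refine timelike_not_orthogonal hB hi hX (Y := (w - a • X) + s • Y) ?_ ?_
  · have h1 : B ((w - a • X) + s • Y) ((w - a • X) + s • Y)
        = B (w - a • X) (w - a • X) + 2 * s * B Y w := by
      rw [LinearMap.BilinForm.add_left, LinearMap.BilinForm.add_right,
        LinearMap.BilinForm.add_right, LinearMap.BilinForm.smul_right,
        LinearMap.BilinForm.smul_left, LinearMap.BilinForm.smul_left,
        LinearMap.BilinForm.smul_right, hY, hB (w - a • X) Y, LinearMap.BilinForm.sub_right Y,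
        LinearMap.BilinForm.smul_right, hYX]
      ring
    rw [h1, hsY]; linarith
  · simp [hXY, haX]

end LorentzForm

variable {ι : Type*} {n q : ℕ} {M : Type*} [TopologicalSpace M]
  [ChartedSpace (EuclideanSpace ℝ (Fin n)) M] [IsManifold (𝓡 n) ∞ M]
  {F : Foliation ι n q M} {G : TransverseLorentzMetric F} (T : TimeOrientation G)

/-! ### Timewedges and causal wedges as half cones. -/

namespace TransverseLorentzMetric

instance (x : M) : FiniteDimensional ℝ (TangentSpace (𝓡 n) x) :=
  inferInstanceAs (FiniteDimensional ℝ (EuclideanSpace ℝ (Fin n)))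

theorem ne_zero_of_timelike (G : TransverseLorentzMetric F) {x : M} {X Y : TangentSpace (𝓡 n) x}
    (hX : G.g x X X < 0) (hY : G.g x Y Y < 0) : G.g x Y X ≠ 0 :=
  timelike_not_orthogonal (B := (G.g x).toBilinForm) (G.symm x) (G.index_one x) hY hX

/-- A lightlike vector orthogonal to a timelike one lies in the radical, hence is tangent to the
leaf, which the definition of lightlike excludes. -/
theorem ne_zero_of_causal (G : TransverseLorentzMetric F) {x : M} {X Y : TangentSpace (𝓡 n) x}
    (hX : G.g x X X < 0) (hY : Y ∈ G.causal x) : G.g x Y X ≠ 0 := by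
  rcases hY with hY | ⟨hYt, hY⟩
  · exact G.ne_zero_of_timelike hX hY
  · intro h0
    exact hYt (G.nondegenerate x Y fun w =>
      null_orthogonal_timelike (B := (G.g x).toBilinForm) (G.symm x) (G.index_one x) hX hY
        (by rw [← h0]; exact G.symm x X Y) w)

theorem continuous_left (G : TransverseLorentzMetric F) (x : M) (X : TangentSpace (𝓡 n) x) :
    Continuous fun v : TangentSpace (𝓡 n) x => G.g x v X := by
  have h (B : EuclideanSpace ℝ (Fin n) →L[ℝ] EuclideanSpace ℝ (Fin n) →L[ℝ] ℝ)
      (X : EuclideanSpace ℝ (Fin n)) : Continuous fun v => B v X := by fun_prop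
  exact h (G.g x) X

end TransverseLorentzMetric

namespace TimeOrientation

theorem timelike_of_mem_wedge {x : M} {X : TangentSpace (𝓡 n) x} (hX : X ∈ T.wedge x) :
    G.g x X X < 0 := by
  obtain ⟨v, -, hW⟩ := T.isTimewedge x
  rw [hW] at hX
  exact connectedComponentIn_subset (G.timelike x) v hX

/-- The future timewedge, described by one of its vectors. -/
theorem mem_wedge_iff {x : M} {X : TangentSpace (𝓡 n) x} (hX : X ∈ T.wedge x)
    (v : TangentSpace (𝓡 n) x) : v ∈ T.wedge x ↔ G.g x v v < 0 ∧ G.g x v X < 0 := by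
  have hXX := T.timelike_of_mem_wedge hX
  obtain ⟨v₀, -, hW⟩ := T.isTimewedge x
  have hWX : T.wedge x = connectedComponentIn (G.timelike x) X := by
    rw [hW] at hX ⊢
    exact connectedComponentIn_eq hX
  constructor
  · intro hv
    have hvv := T.timelike_of_mem_wedge hv
    refine ⟨hvv, ?_⟩
    by_contra hcon
    push Not at hcon
    -- On the connected wedge the function `g(·, X)` never vanishes, so it keeps the sign it has at
    -- `X`.
    have hpre : IsPreconnected (T.wedge x) := by rw [hWX]; exact isPreconnected_connectedComponentIn
    obtain ⟨w, hw, hw0⟩ := hpre.intermediate_value hX hv (G.continuous_left x X).continuousOn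
      (show (0 : ℝ) ∈ Icc (G.g x X X) (G.g x v X) from ⟨hXX.le, hcon⟩)
    exact G.ne_zero_of_timelike hXX (T.timelike_of_mem_wedge hw) hw0
  · rintro ⟨hvv, hvX⟩
    -- Conversely, the segment from `X` to `v` stays timelike because all three terms of the
    -- expanded square are nonpositive and one is negative.
    have hseg : IsPreconnected ((fun s : ℝ => X + s • (v - X)) '' Icc 0 1) := by
      refine isPreconnected_Icc.image _ (Continuous.continuousOn ?_)
      fun_prop
    rw [hWX]
    refine hseg.subset_connectedComponentIn (x := X) ⟨0, by simp, by simp⟩ ?_ ⟨1, by simp, by simp⟩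
    rintro _ ⟨s, hs, rfl⟩
    have hval : G.g x (X + s • (v - X)) (X + s • (v - X)) =
        (1 - s) ^ 2 * G.g x X X + 2 * s * (1 - s) * G.g x v X + s ^ 2 * G.g x v v := by
      have := G.symm x X v
      simp only [map_add, map_sub, map_smul, add_apply,
        sub_apply, smul_apply, smul_eq_mul]
      rw [this]; ring
    change G.g x (X + s • (v - X)) (X + s • (v - X)) < 0
    rw [hval]
    have h1 : 0 ≤ s * (1 - s) := mul_nonneg hs.1 (by linarith [hs.2])
    rcases eq_or_lt_of_le hs.1 with h | h
    · rw [← h]; simpa using hXX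
    · nlinarith [sq_nonneg (1 - s), sq_pos_of_pos h]

/-- The future causal wedge, described by a vector of the future timewedge. -/
theorem mem_causalWedge_iff {x : M} {X : TangentSpace (𝓡 n) x} (hX : X ∈ T.wedge x)
    (v : TangentSpace (𝓡 n) x) : v ∈ T.causalWedge x ↔ G.g x v v ≤ 0 ∧ G.g x v X < 0 := by
  have hXX := T.timelike_of_mem_wedge hX
  constructor
  · rintro ⟨hv, hcl⟩
    refine ⟨?_, lt_of_le_of_ne ?_ (G.ne_zero_of_causal hXX hv)⟩
    · rcases hv with hv | hv
      · exact le_of_lt hv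
      · exact le_of_eq hv.2
    · have hclosed : IsClosed {w : TangentSpace (𝓡 n) x | G.g x w X ≤ 0} :=
        isClosed_le (G.continuous_left x X) continuous_const
      exact closure_minimal (fun w hw => ((T.mem_wedge_iff hX w).1 hw).2.le) hclosed hcl
  · rintro ⟨hvv, hvX⟩
    constructor
    · rcases lt_or_eq_of_le hvv with h | h
      · exact Or.inl h
      · exact Or.inr ⟨fun ht => hvX.ne (G.basic.left x v ht X), h⟩
    -- Pushing `v` slightly towards `X` makes it strictly timelike, which exhibits it as a limit of
    -- wedge vectors.
    · have hlim : Filter.Tendsto (fun s : ℝ => v + s • X) (𝓝[>] 0) (𝓝 v) := by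
        have : Continuous fun s : ℝ => v + s • X := by fun_prop
        have h := (this.tendsto 0).mono_left (nhdsWithin_le_nhds (s := Ioi 0))
        simpa using h
      refine mem_closure_of_tendsto hlim ?_
      filter_upwards [self_mem_nhdsWithin] with s hs
      have hs : 0 < s := hs
      rw [T.mem_wedge_iff hX]
      have hsym := G.symm x X v
      have e1 : G.g x (v + s • X) (v + s • X) =
          G.g x v v + 2 * s * G.g x v X + s ^ 2 * G.g x X X := by
        simp only [map_add, map_smul, add_apply,
          smul_apply, smul_eq_mul]
        rw [hsym]; ring
      have e2 : G.g x (v + s • X) X = G.g x v X + s * G.g x X X := by simp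
      rw [e1, e2]
      constructor <;> nlinarith [mul_pos hs hs]

theorem wedge_subset_causalWedge (x : M) : T.wedge x ⊆ T.causalWedge x := fun _ hv =>
  ⟨Or.inl (T.timelike_of_mem_wedge hv), subset_closure hv⟩

end TimeOrientation

end LorentzFoliation
end

/-! ### Smooth segments, time reversal and concatenation. -/

noncomputable section

namespace LorentzFoliation

variable {n : ℕ} {M : Type*} [TopologicalSpace M]
  [ChartedSpace (EuclideanSpace ℝ (Fin n)) M]
  {C : ∀ x : M, Set (TangentSpace (𝓡 n) x)} {α β : ℝ → M} {a b c d : ℝ} {x y z : M}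

/-- `α` restricts to a smooth curve on `[a, b]` whose velocity vectors lie in the cone field `C`. -/
structure IsSmoothIn (C : ∀ x : M, Set (TangentSpace (𝓡 n) x)) (α : ℝ → M) (a b : ℝ) : Prop where
  lt : a < b
  smooth : ContMDiffOn 𝓘(ℝ, ℝ) (𝓡 n) ∞ α (Icc a b)
  mem : ∀ s ∈ Icc a b,
    (mfderivWithin 𝓘(ℝ, ℝ) (𝓡 n) α (Icc a b) s (1 : ℝ) : TangentSpace (𝓡 n) (α s)) ∈ C (α s)

/-- A single smooth segment with velocities in `C` leads from `x` to `y`. -/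
def Seg (C : ∀ x : M, Set (TangentSpace (𝓡 n) x)) (x y : M) : Prop :=
  ∃ α a b, IsSmoothIn C α a b ∧ α a = x ∧ α b = y

/-- Finitely many smooth segments with velocities in `C` lead from `x` to `y`. -/
def Reach (C : ∀ x : M, Set (TangentSpace (𝓡 n) x)) : M → M → Prop := Relation.TransGen (Seg C)

/-- The time-reversed cone field. -/
def reverse (C : ∀ x : M, Set (TangentSpace (𝓡 n) x)) (x : M) : Set (TangentSpace (𝓡 n) x) :=
  {v | -v ∈ C x}

theorem reverse_reverse (C : ∀ x : M, Set (TangentSpace (𝓡 n) x)) : reverse (reverse C) = C := by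
  ext x v
  simp [reverse]

/-- Curves that agree have velocities over base points that are equal only propositionally; all
tangent spaces are the same model space, so the vector itself need not be transported. -/
theorem mem_cone_congr (C : ∀ x : M, Set (TangentSpace (𝓡 n) x)) (h : x = y)
    (v : EuclideanSpace ℝ (Fin n)) (hv : (v : TangentSpace (𝓡 n) x) ∈ C x) :
    (v : TangentSpace (𝓡 n) y) ∈ C y := by
  subst h; exact hv

theorem IsSmoothIn.seg (h : IsSmoothIn C α a b) : Seg C (α a) (α b) := ⟨α, a, b, h, rfl, rfl⟩

theorem IsSmoothIn.uniqueMDiffWithinAt (h : IsSmoothIn C α a b) {s : ℝ} (hs : s ∈ Icc a b) :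
    UniqueMDiffWithinAt 𝓘(ℝ, ℝ) (Icc a b) s :=
  ((uniqueDiffOn_Icc h.lt) s hs).uniqueMDiffWithinAt

theorem IsSmoothIn.mdifferentiableWithinAt (h : IsSmoothIn C α a b) {s : ℝ} (hs : s ∈ Icc a b) :
    MDifferentiableWithinAt 𝓘(ℝ, ℝ) (𝓡 n) α (Icc a b) s :=
  (h.smooth s hs).mdifferentiableWithinAt (by simp)

theorem IsSmoothIn.continuousOn (h : IsSmoothIn C α a b) : ContinuousOn α (Icc a b) :=
  h.smooth.continuousOn

theorem IsSmoothIn.mono (h : IsSmoothIn C α a b) (hc : a ≤ c) (hcd : c < d) (hd : d ≤ b) :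
    IsSmoothIn C α c d where
  lt := hcd
  smooth := h.smooth.mono (Icc_subset_Icc hc hd)
  mem s hs := by
    have hs' : s ∈ Icc a b := Icc_subset_Icc hc hd hs
    rw [mfderivWithin_subset (Icc_subset_Icc hc hd)
      ((uniqueDiffOn_Icc hcd) s hs).uniqueMDiffWithinAt (h.mdifferentiableWithinAt hs')]
    exact h.mem s hs'

theorem IsSmoothIn.congr (h : IsSmoothIn C α a b) (hβ : EqOn β α (Icc a b)) :
    IsSmoothIn C β a b where
  lt := h.lt
  smooth := h.smooth.congr hβ
  mem s hs := by
    have := mfderivWithin_congr (I := 𝓘(ℝ, ℝ)) (I' := 𝓡 n) hβ (hβ hs)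
    refine mem_cone_congr C (hβ hs).symm _ ?_
    rw [this]
    exact h.mem s hs

/-- Reparametrization by an affine map `s ↦ m s + k` with `m = ±1`. -/
theorem IsSmoothIn.comp_affine (h : IsSmoothIn C α a b) {D : ∀ x : M, Set (TangentSpace (𝓡 n) x)}
    {m k : ℝ} (hD : ∀ x, ∀ v : TangentSpace (𝓡 n) x, v ∈ C x → m • v ∈ D x) (hcd : c < d)
    (hmap : MapsTo (fun s => m * s + k) (Icc c d) (Icc a b)) :
    IsSmoothIn D (fun s => α (m * s + k)) c d where
  lt := hcd
  smooth := by
    refine h.smooth.comp (ContDiff.contMDiff ?_).contMDiffOn hmap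
    fun_prop
  mem s hs := by
    have h1 : HasMFDerivWithinAt 𝓘(ℝ, ℝ) 𝓘(ℝ, ℝ) (fun s : ℝ => m * s + k) (Icc c d) s
        (ContinuousLinearMap.toSpanSingleton ℝ m) := by
      have : HasDerivAt (fun s : ℝ => m * s + k) m s := by
        simpa using ((hasDerivAt_id s).const_mul m).add_const k
      exact this.hasFDerivAt.hasFDerivWithinAt.hasMFDerivWithinAt
    have h2 := ((h.mdifferentiableWithinAt (hmap hs)).hasMFDerivWithinAt).comp s h1 hmap.subset_preimage
    have h3 := h2.mfderivWithin ((uniqueDiffOn_Icc hcd) s hs).uniqueMDiffWithinAt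
    have h4 := hD _ _ (h.mem _ (hmap hs))
    change mfderivWithin 𝓘(ℝ, ℝ) (𝓡 n) (α ∘ fun s => m * s + k) (Icc c d) s (1 : ℝ) ∈ _
    have h5 : (mfderivWithin 𝓘(ℝ, ℝ) (𝓡 n) α (Icc a b) (m * s + k)) (m • (1 : ℝ)) =
        m • (mfderivWithin 𝓘(ℝ, ℝ) (𝓡 n) α (Icc a b) (m * s + k)) (1 : ℝ) :=
      ContinuousLinearMap.map_smul _ _ _
    rw [← h5] at h4
    rw [h3]
    have h6 := congrArg (mfderivWithin 𝓘(ℝ, ℝ) (𝓡 n) α (Icc a b) (m * s + k))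
      (show (ContinuousLinearMap.toSpanSingleton ℝ m) (1 : ℝ) = m • (1 : ℝ) by simp)
    exact (congrArg (fun v => v ∈ D (α (m * s + k))) h6).mpr h4

theorem Seg.reverse (h : Seg C x y) : Seg (reverse C) y x := by
  obtain ⟨α, a, b, h, rfl, rfl⟩ := h
  refine ⟨fun s => α (-1 * s + 0), -b, -a, h.comp_affine (fun x v hv => ?_) (by linarith [h.lt])
    (fun s hs => ⟨by linarith [hs.2], by linarith [hs.1]⟩), by simp, by simp⟩
  simpa [LorentzFoliation.reverse] using hv

theorem seg_reverse_iff : Seg (reverse C) x y ↔ Seg C y x :=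
  ⟨fun h => by simpa [reverse_reverse] using h.reverse, Seg.reverse⟩

/-- This is the duality by which results about moving the end of a curve also apply to its start. -/
theorem reach_reverse_iff : Reach (reverse C) x y ↔ Reach C y x := by
  have : Seg (reverse C) = Function.swap (Seg C) := by
    ext x y; exact seg_reverse_iff
  rw [Reach, this, Relation.transGen_swap]; rfl

theorem Seg.reach (h : Seg C x y) : Reach C x y := Relation.TransGen.single h

theorem Seg.split (h : Seg C x y) : ∃ z, Seg C x z ∧ Seg C z y := by
  obtain ⟨α, a, b, h, rfl, rfl⟩ := h
  have := h.lt
  exact ⟨α ((a + b) / 2), (h.mono le_rfl (by linarith) (by linarith)).seg,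
    (h.mono (by linarith) (by linarith) le_rfl).seg⟩

theorem Reach.split (h : Reach C x y) : ∃ z, Reach C x z ∧ Reach C z y := by
  rcases Relation.TransGen.tail'_iff.1 h with ⟨w, hxw, hwy⟩
  obtain ⟨z, h1, h2⟩ := hwy.split
  exact ⟨z, Relation.TransGen.tail' hxw h1, h2.reach⟩

theorem Seg.mono {D : ∀ x : M, Set (TangentSpace (𝓡 n) x)} (hCD : ∀ x, C x ⊆ D x)
    (h : Seg C x y) : Seg D x y := by
  obtain ⟨α, a, b, h, hx, hy⟩ := h
  exact ⟨α, a, b, ⟨h.lt, h.smooth, fun s hs => hCD _ (h.mem s hs)⟩, hx, hy⟩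

theorem Reach.mono {D : ∀ x : M, Set (TangentSpace (𝓡 n) x)} (hCD : ∀ x, C x ⊆ D x)
    (h : Reach C x y) : Reach D x y := by
  induction h with
  | single h => exact (h.mono hCD).reach
  | tail _ h ih => exact ih.tail (h.mono hCD)

theorem isPiecewiseSmoothIn_iff : IsPiecewiseSmoothIn C α a b ↔
    ∃ (k : ℕ) (t : Fin (k + 1) → ℝ), StrictMono t ∧ t 0 = a ∧ t (Fin.last k) = b ∧
      ∀ i : Fin k, IsSmoothIn C α (t i.castSucc) (t i.succ) := by
  constructor
  · rintro ⟨k, t, ht, h0, h1, h⟩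
    exact ⟨k, t, ht, h0, h1, fun i => ⟨ht Fin.castSucc_lt_succ, (h i).1, (h i).2⟩⟩
  · rintro ⟨k, t, ht, h0, h1, h⟩
    exact ⟨k, t, ht, h0, h1, fun i => ⟨(h i).smooth, (h i).mem⟩⟩

theorem IsPiecewiseSmoothIn.reach (hab : a < b) (h : IsPiecewiseSmoothIn C α a b) :
    Reach C (α a) (α b) := by
  obtain ⟨k, t, ht, rfl, rfl, hs⟩ := isPiecewiseSmoothIn_iff.1 h
  have key : ∀ i : Fin (k + 1), Relation.ReflTransGen (Seg C) (α (t 0)) (α (t i)) := by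
    intro i
    induction i using Fin.induction with
    | zero => exact .refl
    | succ i ih => exact ih.tail (hs i).seg
  cases k with
  | zero => exact absurd hab (by simp)
  | succ k => exact Relation.TransGen.tail' (key (Fin.last k).castSucc) (hs (Fin.last k)).seg

theorem IsSmoothIn.isPiecewiseSmoothIn (h : IsSmoothIn C α a b) : IsPiecewiseSmoothIn C α a b := by
  refine isPiecewiseSmoothIn_iff.2 ⟨1, ![a, b], ?_, rfl, rfl, fun i => ?_⟩
  · intro i j hij
    fin_cases i <;> fin_cases j <;> simp_all [h.lt]
  · fin_cases i
    exact h

theorem IsPiecewiseSmoothIn.append (hab : a < b) (h : IsPiecewiseSmoothIn C α a b)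
    (hβ : IsSmoothIn C β c d) (hc : α b = β c) :
    ∃ γ e, a < e ∧ IsPiecewiseSmoothIn C γ a e ∧ γ a = α a ∧ γ e = β d := by
  obtain ⟨k, t, ht, rfl, rfl, hs⟩ := isPiecewiseSmoothIn_iff.1 h
  set b := t (Fin.last k) with hb
  have hcd := hβ.lt
  -- At `b` both branches agree by `hc`, so on each closed interval of the new partition `γ`
  -- coincides with one smooth curve; nothing is needed across the break point.
  let γ : ℝ → M := fun s => if s ≤ b then α s else β (1 * s + (c - b))
  have hγ₁ : ∀ s ≤ b, γ s = α s := fun s hs => if_pos hs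
  have hγ₂ : ∀ s, b ≤ s → γ s = β (1 * s + (c - b)) := by
    intro s hs
    rcases eq_or_lt_of_le hs with rfl | hs
    · rw [hγ₁ b le_rfl, hc]; congr 1; ring
    · exact if_neg (not_le.2 hs)
  have hlt : b < b + (d - c) := by linarith
  refine ⟨γ, b + (d - c), hab.trans hlt, isPiecewiseSmoothIn_iff.2
    ⟨k + 1, Fin.snoc t (b + (d - c)), ?_, ?_, ?_, fun i => ?_⟩, hγ₁ _ hab.le, ?_⟩
  · rw [Fin.strictMono_iff_lt_succ]
    intro i
    induction i using Fin.lastCases with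
    | last =>
      rw [Fin.succ_last, Fin.snoc_last, Fin.snoc_castSucc]
      exact hlt
    | cast i =>
      rw [Fin.succ_castSucc, Fin.snoc_castSucc, Fin.snoc_castSucc]
      exact ht Fin.castSucc_lt_succ
  · exact Fin.snoc_castSucc (α := fun _ => ℝ) (b + (d - c)) t 0
  · simp
  · induction i using Fin.lastCases with
    | last =>
      have h1 : IsSmoothIn C (fun s => β (1 * s + (c - b))) b (b + (d - c)) :=
        hβ.comp_affine (fun x v hv => by simpa using hv) hlt
          (fun s hs => ⟨by linarith [hs.1], by linarith [hs.2]⟩)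
      simpa [hb] using h1.congr (fun s hs => hγ₂ s hs.1)
    | cast i =>
      rw [Fin.succ_castSucc, Fin.snoc_castSucc, Fin.snoc_castSucc]
      exact (hs i).congr fun s hs => hγ₁ s (hs.2.trans (ht.monotone (Fin.le_last _)))
  · rw [hγ₂ _ hlt.le]; congr 1; ring

/-- Chains of segments, each with its own parameter interval, can replace partitions of a single
interval from here on. -/
theorem reach_iff_exists_isPiecewiseSmoothIn : Reach C x y ↔
    ∃ (α : ℝ → M) (a b : ℝ), a < b ∧ IsPiecewiseSmoothIn C α a b ∧ α a = x ∧ α b = y := by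
  constructor
  · intro h
    induction h with
    | single h =>
      obtain ⟨α, a, b, h, hx, hy⟩ := h
      exact ⟨α, a, b, h.lt, h.isPiecewiseSmoothIn, hx, hy⟩
    | tail _ h ih =>
      obtain ⟨α, a, b, hab, hα, hx, hy⟩ := ih
      obtain ⟨β, c, d, hβ, hc, hd⟩ := h
      obtain ⟨γ, e, hae, hγ, h1, h2⟩ := hα.append hab hβ (hy.trans hc.symm)
      exact ⟨γ, a, e, hae, hγ, h1.trans hx, h2.trans hd⟩
  · rintro ⟨α, a, b, hab, h, rfl, rfl⟩
    exact h.reach hab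

end LorentzFoliation
end

/-! ### Cone fields read in a chart, and deformations of curves there. -/

noncomputable section

namespace LorentzFoliation

variable {n : ℕ} {M : Type*} [TopologicalSpace M]
  [ChartedSpace (EuclideanSpace ℝ (Fin n)) M]
  {C : ∀ x : M, Set (TangentSpace (𝓡 n) x)} {α : ℝ → M} {a b : ℝ} {x y y₁ y₂ : M}

/-- In the chart `e`, over the convex open set `B`, the cone field `C` reads as `K`. -/
structure ConeChart (C : ∀ x : M, Set (TangentSpace (𝓡 n) x))
    (K : EuclideanSpace ℝ (Fin n) → Set (EuclideanSpace ℝ (Fin n)))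
    (e : OpenPartialHomeomorph M (EuclideanSpace ℝ (Fin n)))
    (B : Set (EuclideanSpace ℝ (Fin n))) : Prop where
  mem_atlas : e ∈ IsManifold.maximalAtlas (𝓡 n) ∞ M
  isOpen : IsOpen B
  convex : Convex ℝ B
  subset : B ⊆ e.target
  mem_iff : ∀ x ∈ e.source, e x ∈ B → ∀ v : TangentSpace (𝓡 n) x,
    v ∈ C x ↔ (mfderiv (𝓡 n) (𝓡 n) e x v : EuclideanSpace ℝ (Fin n)) ∈ K (e x)

namespace ConeChart

variable {K : EuclideanSpace ℝ (Fin n) → Set (EuclideanSpace ℝ (Fin n))}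
  {e : OpenPartialHomeomorph M (EuclideanSpace ℝ (Fin n))}
  {B : Set (EuclideanSpace ℝ (Fin n))} (hc : ConeChart C K e B)

include hc

theorem mdifferentiableAt (hx : x ∈ e.source) : MDifferentiableAt (𝓡 n) (𝓡 n) e x :=
  (contMDiffAt_of_mem_maximalAtlas hc.mem_atlas hx).mdifferentiableAt (by simp)

theorem hasDerivWithinAt (h : IsSmoothIn C α a b) {s : ℝ} (hs : s ∈ Icc a b)
    (hx : α s ∈ e.source) :
    HasDerivWithinAt (e ∘ α)
      (mfderiv (𝓡 n) (𝓡 n) e (α s) (mfderivWithin 𝓘(ℝ, ℝ) (𝓡 n) α (Icc a b) s (1 : ℝ)) :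
        EuclideanSpace ℝ (Fin n)) (Icc a b) s := by
  have h1 := (hc.mdifferentiableAt hx).hasMFDerivAt.comp_hasMFDerivWithinAt s
    (h.mdifferentiableWithinAt hs).hasMFDerivWithinAt
  let L : ℝ →L[ℝ] EuclideanSpace ℝ (Fin n) :=
    (mfderiv (𝓡 n) (𝓡 n) e (α s)).comp (mfderivWithin 𝓘(ℝ, ℝ) (𝓡 n) α (Icc a b) s)
  have h2 : HasFDerivWithinAt (e ∘ α) L (Icc a b) s := hasMFDerivWithinAt_iff_hasFDerivWithinAt.1 h1
  exact h2.hasDerivWithinAt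

theorem contDiffOn (h : IsSmoothIn C α a b) (hx : ∀ s ∈ Icc a b, α s ∈ e.source) :
    ContDiffOn ℝ ∞ (e ∘ α) (Icc a b) :=
  contMDiffOn_iff_contDiffOn.1
    ((contMDiffOn_of_mem_maximalAtlas hc.mem_atlas).comp h.smooth hx)

theorem derivWithin_mem (h : IsSmoothIn C α a b) {s : ℝ} (hs : s ∈ Icc a b)
    (hx : α s ∈ e.source) (hB : e (α s) ∈ B) :
    derivWithin (e ∘ α) (Icc a b) s ∈ K (e (α s)) := by
  rw [(hc.hasDerivWithinAt h hs hx).derivWithin (uniqueDiffOn_Icc h.lt s hs)]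
  exact (hc.mem_iff _ hx hB _).1 (h.mem s hs)

/-- Deformed curves are written in the chart, where vectors can be added; this carries them back to
the manifold. -/
theorem isSmoothIn_symm (hab : a < b) {c : ℝ → EuclideanSpace ℝ (Fin n)}
    (hsm : ContDiffOn ℝ ∞ c (Icc a b)) (hB : ∀ s ∈ Icc a b, c s ∈ B)
    (hK : ∀ s ∈ Icc a b, derivWithin c (Icc a b) s ∈ K (c s)) :
    IsSmoothIn C (e.symm ∘ c) a b where
  lt := hab
  smooth := (contMDiffOn_symm_of_mem_maximalAtlas hc.mem_atlas).comp
    (contMDiffOn_iff_contDiffOn.2 hsm) fun s hs => hc.subset (hB s hs)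
  mem s hs := by
    have ht := hc.subset (hB s hs)
    have hx : e.symm (c s) ∈ e.source := e.map_target ht
    have h1 : MDifferentiableWithinAt 𝓘(ℝ, ℝ) (𝓡 n) (e.symm ∘ c) (Icc a b) s :=
      ((contMDiffOn_symm_of_mem_maximalAtlas hc.mem_atlas).comp
        (contMDiffOn_iff_contDiffOn.2 hsm) (fun s hs => hc.subset (hB s hs)) s hs
        ).mdifferentiableWithinAt (by simp)
    have h2 : HasMFDerivWithinAt 𝓘(ℝ, ℝ) (𝓡 n) (e ∘ (e.symm ∘ c)) (Icc a b) s _ :=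
      (hc.mdifferentiableAt hx).hasMFDerivAt.comp_hasMFDerivWithinAt s h1.hasMFDerivWithinAt
    let L : ℝ →L[ℝ] EuclideanSpace ℝ (Fin n) := (mfderiv (𝓡 n) (𝓡 n) e (e.symm (c s))).comp
      (mfderivWithin 𝓘(ℝ, ℝ) (𝓡 n) (e.symm ∘ c) (Icc a b) s)
    have h2' : HasFDerivWithinAt (e ∘ (e.symm ∘ c)) L (Icc a b) s :=
      hasMFDerivWithinAt_iff_hasFDerivWithinAt.1 h2
    have h3 := h2'.hasDerivWithinAt
    have h4 := h3.congr (f₁ := c) (fun t ht => (e.right_inv (hc.subset (hB t ht))).symm)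
      (e.right_inv ht).symm
    refine (hc.mem_iff _ hx (by rw [e.right_inv ht]; exact hB s hs) _).2 ?_
    have h5 := hK s hs
    rw [h4.derivWithin (uniqueDiffOn_Icc hab s hs)] at h5
    change _ ∈ K (e (e.symm (c s)))
    rw [e.right_inv ht]
    exact h5

end ConeChart

theorem exists_Icc_of_eventually_nhdsWithin (hab : a < b) {Q : ℝ → Prop}
    (h : ∀ᶠ t in 𝓝[Icc a b] b, Q t) : ∃ t₀ ∈ Ioo a b, ∀ t ∈ Icc t₀ b, Q t := by
  rw [nhdsWithin_Icc_eq_nhdsLE hab] at h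
  obtain ⟨l, hl, hsub⟩ := mem_nhdsLE_iff_exists_Icc_subset.1 h
  have h1 : l < b := hl
  -- The midpoint keeps `t₀` strictly inside, so that both `[a, t₀]` and `[t₀, b]` are genuine
  -- segments.
  refine ⟨max l ((a + b) / 2), ⟨lt_max_of_lt_right (by linarith), max_lt h1 (by linarith)⟩,
    fun t ht => hsub ⟨(le_max_left _ _).trans ht.1, ht.2⟩⟩

namespace ConeChart

variable {K : EuclideanSpace ℝ (Fin n) → Set (EuclideanSpace ℝ (Fin n))}
  {e : OpenPartialHomeomorph M (EuclideanSpace ℝ (Fin n))}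
  {B : Set (EuclideanSpace ℝ (Fin n))} (hc : ConeChart C K e B)

include hc

/-- The end of a curve may be moved in directions along which the cone field is invariant. -/
theorem reach_slide (hy₁ : y₁ ∈ e.source) (hB₁ : e y₁ ∈ B) (hy₂ : y₂ ∈ e.source) (hB₂ : e y₂ ∈ B)
    (hK : ∀ u ∈ B, ∀ s : ℝ, u + s • (e y₂ - e y₁) ∈ B → ∀ v ∈ K u, ∀ r : ℝ,
      v + r • (e y₂ - e y₁) ∈ K (u + s • (e y₂ - e y₁)))
    (h : Seg C x y₁) : Reach C x y₂ := by
  obtain ⟨α, a, b, h, rfl, rfl⟩ := h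
  have hab := h.lt
  set z := e y₂ - e (α b) with hz
  have hbm : b ∈ Icc a b := right_mem_Icc.2 hab.le
  have hcont : ContinuousWithinAt α (Icc a b) b := h.continuousOn b hbm
  have hcont' : ContinuousWithinAt (e ∘ α) (Icc a b) b :=
    (e.continuousAt hy₁).comp_continuousWithinAt hcont
  have ev1 : ∀ᶠ t in 𝓝[Icc a b] b, α t ∈ e.source := hcont (e.open_source.mem_nhds hy₁)
  have ev2 : ∀ᶠ t in 𝓝[Icc a b] b, e (α t) ∈ B := hcont' (hc.isOpen.mem_nhds hB₁)
  have ev3 : ∀ᶠ t in 𝓝[Icc a b] b, e (α t) + z ∈ B := by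
    refine (hcont'.add continuousWithinAt_const) (hc.isOpen.mem_nhds ?_)
    simpa [hz] using hB₂
  obtain ⟨t₀, ht₀, hQ⟩ := exists_Icc_of_eventually_nhdsWithin hab (ev1.and (ev2.and ev3))
  have hI := h.mono ht₀.1.le ht₀.2 le_rfl
  have hpos : 0 < b - t₀ := sub_pos.2 ht₀.2
  -- As `σ` rises from `0` to `1` on `[t₀, b]`, adding `σ t • z` fixes the point at `t₀` and moves
  -- the end to `y₂`. The velocity changes by a multiple of `z`, which `hK` allows.
  let σ : ℝ → ℝ := fun t => (t - t₀) / (b - t₀)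
  have hσd : ∀ t, HasDerivAt σ (1 / (b - t₀)) t := fun t =>
    ((hasDerivAt_id t).sub_const t₀).div_const _
  have hsm := hc.contDiffOn hI fun t ht => (hQ t ht).1
  have hB' : ∀ t ∈ Icc t₀ b, (e ∘ α) t + σ t • z ∈ B := by
    intro t ht
    obtain ⟨-, h2, h3⟩ := hQ t ht
    have h0 : 0 ≤ σ t := div_nonneg (sub_nonneg.2 ht.1) hpos.le
    have h1 : σ t ≤ 1 := (div_le_one hpos).2 (by linarith [ht.2])
    have := hc.convex.add_smul_mem h2 h3 ⟨h0, h1⟩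
    exact this
  have hnew : IsSmoothIn C (e.symm ∘ fun t => (e ∘ α) t + σ t • z) t₀ b := by
    refine hc.isSmoothIn_symm ht₀.2 ?_ hB' ?_
    · have hσ : ContDiff ℝ ∞ σ := (contDiff_id.sub contDiff_const).div_const _
      have hσz : ContDiff ℝ ∞ fun t => σ t • z := hσ.smul contDiff_const
      exact hsm.add hσz.contDiffOn
    · intro t ht
      have hd := (hsm.differentiableOn (by simp) t ht).hasDerivWithinAt
      have hd' := hd.add ((hσd t).hasDerivWithinAt.smul_const z)
      have hm := hc.derivWithin_mem hI ht (hQ t ht).1 (hQ t ht).2.1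
      have h4 := hK _ (hQ t ht).2.1 (σ t) (hB' t ht) _ hm (1 / (b - t₀))
      rw [← hd'.derivWithin (uniqueDiffOn_Icc ht₀.2 t ht)] at h4
      exact h4
  have hs := hnew.seg
  have e1 : (e.symm ∘ fun t => (e ∘ α) t + σ t • z) t₀ = α t₀ := by
    simp [σ, e.left_inv (hQ t₀ (left_mem_Icc.2 ht₀.2.le)).1]
  have e2 : (e.symm ∘ fun t => (e ∘ α) t + σ t • z) b = y₂ := by
    simp [σ, div_self hpos.ne', hz, e.left_inv hy₂]
  rw [e1, e2] at hs
  exact .tail (.single (h.mono le_rfl ht₀.1 ht₀.2.le).seg) hs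

/-- Straight segments in the chart. -/
theorem seg_of_line {u w : EuclideanSpace ℝ (Fin n)} {ε : ℝ} (hε : 0 < ε) (hu : u ∈ B)
    (hv : u + ε • w ∈ B) (hK : ∀ y ∈ segment ℝ u (u + ε • w), w ∈ K y) :
    Seg C (e.symm u) (e.symm (u + ε • w)) := by
  have hmem : ∀ s ∈ Icc 0 ε, u + s • w ∈ segment ℝ u (u + ε • w) := by
    intro s hs
    rw [segment_eq_image']
    refine ⟨s / ε, ⟨div_nonneg hs.1 hε.le, (div_le_one hε).2 hs.2⟩, ?_⟩
    simp [smul_smul, div_mul_cancel₀ _ hε.ne']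
  have hI : IsSmoothIn C (e.symm ∘ fun s : ℝ => u + s • w) 0 ε := by
    refine hc.isSmoothIn_symm hε (ContDiff.contDiffOn (by fun_prop))
      (fun s hs => hc.convex.segment_subset hu hv (hmem s hs)) fun s hs => ?_
    have hd : HasDerivAt (fun s : ℝ => u + s • w) w s := by
      simpa using ((hasDerivAt_id s).smul_const w).const_add u
    rw [hd.hasDerivWithinAt.derivWithin (uniqueDiffOn_Icc hε s hs)]
    exact hK _ (hmem s hs)
  simpa using hI.seg

/-- The end point of a curve may be moved freely when the cone field is open. -/
theorem eventually_reach (hy : y ∈ e.source) (hB : e y ∈ B)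
    (hK : ∀ v ∈ K (e y), ∀ᶠ p : EuclideanSpace ℝ (Fin n) × EuclideanSpace ℝ (Fin n) in
      𝓝 (e y, v), p.2 ∈ K p.1)
    (h : Seg C x y) : ∀ᶠ y' in 𝓝 y, Reach C x y' := by
  obtain ⟨α, a, b, h, rfl, rfl⟩ := h
  have hab := h.lt
  have hbm : b ∈ Icc a b := right_mem_Icc.2 hab.le
  have hcont : ContinuousWithinAt α (Icc a b) b := h.continuousOn b hbm
  have hcont' : ContinuousWithinAt (e ∘ α) (Icc a b) b :=
    (e.continuousAt hy).comp_continuousWithinAt hcont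
  have hd := hc.hasDerivWithinAt h hbm hy
  have hm := hc.derivWithin_mem h hbm hy hB
  rw [hd.derivWithin (uniqueDiffOn_Icc hab b hbm)] at hm
  set v : EuclideanSpace ℝ (Fin n) :=
    mfderiv (𝓡 n) (𝓡 n) e (α b) (mfderivWithin 𝓘(ℝ, ℝ) (𝓡 n) α (Icc a b) b (1 : ℝ)) with hv
  obtain ⟨δ, hδ, hball⟩ : ∃ δ > 0, ∀ u w, u ∈ Metric.ball (e (α b)) δ → w ∈ Metric.ball v δ →
      u ∈ B ∧ w ∈ K u := by
    have hopen : ∀ᶠ p : EuclideanSpace ℝ (Fin n) × EuclideanSpace ℝ (Fin n) in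
        𝓝 (e (α b), v), p.1 ∈ B ∧ p.2 ∈ K p.1 :=
      (continuousAt_fst.eventually (hc.isOpen.mem_nhds hB)).and (hK v hm)
    obtain ⟨δ, hδ, hsub⟩ := Metric.eventually_nhds_iff_ball.1 hopen
    refine ⟨δ, hδ, fun u w hu hw => hsub (u, w) ?_⟩
    rw [← ball_prod_same]
    exact ⟨hu, hw⟩
  have ev1 : ∀ᶠ t in 𝓝[Icc a b] b, α t ∈ e.source := hcont (e.open_source.mem_nhds hy)
  have ev2 : ∀ᶠ t in 𝓝[Icc a b] b, e (α t) ∈ Metric.ball (e (α b)) δ :=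
    hcont' (Metric.ball_mem_nhds _ hδ)
  -- The secants to the end point converge to the final velocity `v`. A straight segment from `α t₀`
  -- to any point near the end therefore has a direction close to `v`, and replaces the last piece
  -- of the curve.
  have ev3 : ∀ᶠ t in 𝓝[Icc a b \ {b}] b, slope (e ∘ α) b t ∈ Metric.ball v δ :=
    (hasDerivWithinAt_iff_tendsto_slope.1 hd) (Metric.ball_mem_nhds _ hδ)
  have ev4 : ∀ᶠ t in 𝓝[Icc a b] b, t ≠ b → slope (e ∘ α) b t ∈ Metric.ball v δ := by
    rw [sdiff_eq, nhdsWithin_inter', Filter.eventually_inf_principal] at ev3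
    exact ev3
  obtain ⟨t₀, ht₀, hQ⟩ := exists_Icc_of_eventually_nhdsWithin hab (ev1.and (ev2.and ev4))
  obtain ⟨hs₀, hδ₀, hsl₀⟩ := hQ t₀ (left_mem_Icc.2 ht₀.2.le)
  have hsl := hsl₀ ht₀.2.ne
  have hpos : 0 < b - t₀ := sub_pos.2 ht₀.2
  have hce : ContinuousAt e (α b) := e.continuousAt hy
  have ev5 : ∀ᶠ y' in 𝓝 (α b), y' ∈ e.source := e.open_source.mem_nhds hy
  have ev6 : ∀ᶠ y' in 𝓝 (α b), e y' ∈ Metric.ball (e (α b)) δ :=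
    hce (Metric.ball_mem_nhds _ hδ)
  have ev7 : ∀ᶠ y' in 𝓝 (α b), (b - t₀)⁻¹ • (e y' - e (α t₀)) ∈ Metric.ball v δ := by
    have hcc : ContinuousAt (fun y' => (b - t₀)⁻¹ • (e y' - e (α t₀))) (α b) :=
      (hce.sub (continuousAt_const (y := e (α t₀)))).const_smul (b - t₀)⁻¹
    refine hcc (Metric.isOpen_ball.mem_nhds ?_)
    rw [slope_comm] at hsl
    simpa [slope] using hsl
  filter_upwards [ev5, ev6, ev7] with y' h5 h6 h7
  have hlast : e (α t₀) + (b - t₀) • ((b - t₀)⁻¹ • (e y' - e (α t₀))) = e y' := by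
    rw [smul_smul, mul_inv_cancel₀ hpos.ne', one_smul]; abel
  have hseg := hc.seg_of_line hpos (hball _ v hδ₀ (Metric.mem_ball_self hδ)).1
    (w := (b - t₀)⁻¹ • (e y' - e (α t₀)))
    (by rw [hlast]; exact (hball _ v h6 (Metric.mem_ball_self hδ)).1)
    (by
      rw [hlast]
      intro u hu
      exact (hball u _ ((convex_ball _ _).segment_subset hδ₀ h6 hu) h7).2)
  rw [hlast, e.left_inv hs₀, e.left_inv h5] at hseg
  exact .tail (.single (h.mono le_rfl ht₀.1 ht₀.2.le).seg) hseg

/-- A constant vector of the cone field leads to points arbitrarily close to the given one. -/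
theorem frequently_seg (hy : y ∈ e.source) (hB : e y ∈ B) {ξ : EuclideanSpace ℝ (Fin n)}
    (hK : ∀ u ∈ B, ξ ∈ K u) : ∃ᶠ y' in 𝓝 y, Seg C y y' := by
  have hlim : Filter.Tendsto (fun s : ℝ => e y + s • ξ) (𝓝[>] 0) (𝓝 (e y)) := by
    have : Continuous fun s : ℝ => e y + s • ξ := by fun_prop
    have h := (this.tendsto 0).mono_left (nhdsWithin_le_nhds (s := Ioi 0))
    simpa using h
  have hlim' : Filter.Tendsto (fun s : ℝ => e.symm (e y + s • ξ)) (𝓝[>] 0) (𝓝 y) := by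
    have := (e.symm.continuousAt (e.map_source hy)).tendsto.comp hlim
    rwa [e.left_inv hy] at this
  refine hlim'.frequently (Filter.Eventually.frequently ?_)
  filter_upwards [self_mem_nhdsWithin, hlim (hc.isOpen.mem_nhds hB)] with s hs hs'
  have := hc.seg_of_line (u := e y) (w := ξ) hs hB hs'
    fun u hu => hK u (hc.convex.segment_subset hB hs' hu)
  rwa [e.left_inv hy] at this

end ConeChart

end LorentzFoliation
end

/-! ### Local models of the foliation with its cones. -/

noncomputable section

namespace LorentzFoliation

variable {ι : Type*} {n q : ℕ} {M : Type*} [TopologicalSpace M]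
  [ChartedSpace (EuclideanSpace ℝ (Fin n)) M] [IsManifold (𝓡 n) ∞ M]

section Cones

variable {E : Type*} [NormedAddCommGroup E] [NormedSpace ℝ E]

/-- The timelike vectors of the form `h` in the half space of `ξ`. -/
def strictCone (h : E →L[ℝ] E →L[ℝ] ℝ) (ξ : E) : Set E := {v | h v v < 0 ∧ h v ξ < 0}

/-- The causal vectors of the form `h` in the half space of `ξ`. -/
def weakCone (h : E →L[ℝ] E →L[ℝ] ℝ) (ξ : E) : Set E := {v | h v v ≤ 0 ∧ h v ξ < 0}

variable {h : E →L[ℝ] E →L[ℝ] ℝ} {ξ v z : E}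

theorem neg_mem_strictCone : -v ∈ strictCone h ξ ↔ v ∈ strictCone h (-ξ) := by simp [strictCone]

theorem neg_mem_weakCone : -v ∈ weakCone h ξ ↔ v ∈ weakCone h (-ξ) := by simp [weakCone]

theorem add_smul_mem_strictCone (hs : ∀ v w, h v w = h w v) (hz : h z = 0)
    (hv : v ∈ strictCone h ξ) (r : ℝ) : v + r • z ∈ strictCone h ξ := by
  have hvz : h v z = 0 := by rw [hs, hz]; rfl
  simpa [strictCone, hz, hvz] using hv

theorem add_smul_mem_weakCone (hs : ∀ v w, h v w = h w v) (hz : h z = 0)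
    (hv : v ∈ weakCone h ξ) (r : ℝ) : v + r • z ∈ weakCone h ξ := by
  have hvz : h v z = 0 := by rw [hs, hz]; rfl
  simpa [weakCone, hz, hvz] using hv

-- Controls how much the square of a velocity can grow when only its base point is displaced, as
-- happens in tilting a causal curve.
set_option synthInstance.maxHeartbeats 200000 in
theorem apply_sub_apply_le_of_lipschitzOnWith {H : E → E →L[ℝ] E →L[ℝ] ℝ} {L : NNReal} {V : Set E}
    (hL : LipschitzOnWith L H V) {x y : E} (hx : x ∈ V) (hy : y ∈ V) (w : E) :
    H y w w - H x w w ≤ L * ‖y - x‖ * ‖w‖ * ‖w‖ :=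
  calc H y w w - H x w w = (H y - H x) w w := by simp
    _ ≤ ‖(H y - H x) w w‖ := le_abs_self _
    _ ≤ ‖H y - H x‖ * ‖w‖ * ‖w‖ := (H y - H x).le_opNorm₂ w w
    _ ≤ L * ‖y - x‖ * ‖w‖ * ‖w‖ := by
      gcongr
      have := hL.dist_le_mul y hy x hx
      rwa [dist_eq_norm, dist_eq_norm] at this

end Cones

/-- A chart around `p`, foliated by the fibres of the linear map `P`, in which the cone fields `W`
and `J` are the strict and the weak cones of a `C¹` field `h` of symmetric forms that is constant
along the fibres of `P` and degenerate in their directions. -/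
structure LocalModel (F : Foliation ι n q M) (W J : ∀ x : M, Set (TangentSpace (𝓡 n) x))
    (i : ι) (p : M) where
  e : OpenPartialHomeomorph M (EuclideanSpace ℝ (Fin n))
  B : Set (EuclideanSpace ℝ (Fin n))
  P : EuclideanSpace ℝ (Fin n) →L[ℝ] EuclideanSpace ℝ (Fin q)
  h : EuclideanSpace ℝ (Fin n) → EuclideanSpace ℝ (Fin n) →L[ℝ] EuclideanSpace ℝ (Fin n) →L[ℝ] ℝ
  ξ : EuclideanSpace ℝ (Fin n)
  strict : ConeChart W (fun u => strictCone (h u) ξ) e B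
  weak : ConeChart J (fun u => weakCone (h u) ξ) e B
  mem_source : p ∈ e.source
  mem_B : e p ∈ B
  contDiffOn : ContDiffOn ℝ 1 h B
  symm : ∀ u ∈ B, ∀ v w, h u v w = h u w v
  timelike : ∀ u ∈ B, h u ξ ξ < 0
  h_congr : ∀ u ∈ B, ∀ u' ∈ B, P u = P u' → h u = h u'
  h_ker : ∀ u ∈ B, ∀ z, P z = 0 → h u z = 0
  proj : ∀ x ∈ e.source, ∀ x' ∈ e.source, e x ∈ B → e x' ∈ B → F.proj i x = F.proj i x' →
    P (e x) = P (e x')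

variable {F : Foliation ι n q M} {W J : ∀ x : M, Set (TangentSpace (𝓡 n) x)} {i : ι} {p : M}

omit [IsManifold (𝓡 n) ∞ M] in
theorem ConeChart.reverse {C : ∀ x : M, Set (TangentSpace (𝓡 n) x)}
    {K K' : EuclideanSpace ℝ (Fin n) → Set (EuclideanSpace ℝ (Fin n))}
    {e : OpenPartialHomeomorph M (EuclideanSpace ℝ (Fin n))}
    {B : Set (EuclideanSpace ℝ (Fin n))} (hc : ConeChart C K e B)
    (hK : ∀ u v, -v ∈ K u ↔ v ∈ K' u) : ConeChart (reverse C) K' e B where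
  mem_atlas := hc.mem_atlas
  isOpen := hc.isOpen
  convex := hc.convex
  subset := hc.subset
  mem_iff x hx hB v := by
    have h1 := hc.mem_iff x hx hB (-v)
    rw [map_neg] at h1
    exact h1.trans (hK _ _)

namespace LocalModel

/-- Time reversal of a local model. -/
def reverse (m : LocalModel F W J i p) : LocalModel F (reverse W) (reverse J) i p where
  e := m.e
  B := m.B
  P := m.P
  h := m.h
  ξ := -m.ξ
  strict := m.strict.reverse fun _ _ => neg_mem_strictCone
  weak := m.weak.reverse fun _ _ => neg_mem_weakCone
  mem_source := m.mem_source
  mem_B := m.mem_B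
  contDiffOn := m.contDiffOn
  symm := m.symm
  timelike u hu := by simpa using m.timelike u hu
  h_congr := m.h_congr
  h_ker := m.h_ker
  proj := m.proj

variable (m : LocalModel F W J i p)

theorem eventually_mem : ∀ᶠ x in 𝓝 p, x ∈ m.e.source ∧ m.e x ∈ m.B :=
  Filter.inter_mem (m.e.open_source.mem_nhds m.mem_source)
    ((m.e.continuousAt m.mem_source).eventually (m.strict.isOpen.mem_nhds m.mem_B))

theorem h_slide {u z : EuclideanSpace ℝ (Fin n)} (hz : m.P z = 0) (hu : u ∈ m.B) {s : ℝ}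
    (hs : u + s • z ∈ m.B) : m.h (u + s • z) = m.h u :=
  m.h_congr _ hs _ hu (by simp [hz])

/-- Points with equal projection differ in the chart by a vector of `ker P`. The form does not
change along such vectors and has them in its radical, so the cone is invariant under both shifts.
-/
theorem reach_slide_strict {x y₁ y₂ : M} (hy₁ : y₁ ∈ m.e.source ∧ m.e y₁ ∈ m.B)
    (hy₂ : y₂ ∈ m.e.source ∧ m.e y₂ ∈ m.B) (hproj : F.proj i y₁ = F.proj i y₂)
    (h : Seg W x y₁) : Reach W x y₂ := by
  have hP : m.P (m.e y₂ - m.e y₁) = 0 := by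
    rw [map_sub, m.proj _ hy₁.1 _ hy₂.1 hy₁.2 hy₂.2 hproj, sub_self]
  refine m.strict.reach_slide hy₁.1 hy₁.2 hy₂.1 hy₂.2 (fun u hu s hs v hv r => ?_) h
  rw [m.h_slide hP hu hs]
  exact add_smul_mem_strictCone (m.symm u hu) (m.h_ker u hu _ hP) hv r

theorem reach_slide_weak {x y₁ y₂ : M} (hy₁ : y₁ ∈ m.e.source ∧ m.e y₁ ∈ m.B)
    (hy₂ : y₂ ∈ m.e.source ∧ m.e y₂ ∈ m.B) (hproj : F.proj i y₁ = F.proj i y₂)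
    (h : Seg J x y₁) : Reach J x y₂ := by
  have hP : m.P (m.e y₂ - m.e y₁) = 0 := by
    rw [map_sub, m.proj _ hy₁.1 _ hy₂.1 hy₁.2 hy₂.2 hproj, sub_self]
  refine m.weak.reach_slide hy₁.1 hy₁.2 hy₂.1 hy₂.2 (fun u hu s hs v hv r => ?_) h
  rw [m.h_slide hP hu hs]
  exact add_smul_mem_weakCone (m.symm u hu) (m.h_ker u hu _ hP) hv r

theorem continuousAt_h {u : EuclideanSpace ℝ (Fin n)} (hu : u ∈ m.B) : ContinuousAt m.h u :=
  m.contDiffOn.continuousOn.continuousAt (m.strict.isOpen.mem_nhds hu)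

theorem continuousAt_h_apply {u v : EuclideanSpace ℝ (Fin n)} (hu : u ∈ m.B) :
    ContinuousAt (fun p : EuclideanSpace ℝ (Fin n) × EuclideanSpace ℝ (Fin n) => m.h p.1 p.2)
      (u, v) :=
  ((m.continuousAt_h hu).comp (x := (u, v)) continuousAt_fst).clm_apply continuousAt_snd

theorem eventually_reach (m : LocalModel F W J i p) {x : M} (h : Seg W x p) : ∀ᶠ y in 𝓝 p, Reach W x y := by
  refine m.strict.eventually_reach m.mem_source m.mem_B (fun v hv => ?_) h
  have h1 := m.continuousAt_h_apply (v := v) m.mem_B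
  exact ((h1.clm_apply continuousAt_snd).eventually_lt continuousAt_const hv.1).and
    ((h1.clm_apply continuousAt_const).eventually_lt continuousAt_const hv.2)

theorem frequently_seg (m : LocalModel F W J i p) : ∃ᶠ y in 𝓝 p, Seg W p y :=
  m.strict.frequently_seg m.mem_source m.mem_B (ξ := m.ξ)
    fun u hu => ⟨m.timelike u hu, m.timelike u hu⟩

/-- Near the end of a causal curve, the curve may be tilted into a timelike one that starts as close
as desired to a point of the curve. -/
theorem exists_seg_of_causal {β : ℝ → M} {a s : ℝ} (m : LocalModel F W J i (β s))
    (hβ : IsSmoothIn J β a s) {S : Set M} (hS : IsOpen S) :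
    ∃ c₀ ∈ Ico a s, ∀ c ∈ Ioo c₀ s, β c ∈ S → ∃ x ∈ S, Seg W x (β s) := by
  have hsm : s ∈ Icc a s := right_mem_Icc.2 hβ.lt.le
  have ev := hβ.continuousOn s hsm m.eventually_mem
  obtain ⟨t₁, ht₁, hQ₁⟩ := exists_Icc_of_eventually_nhdsWithin hβ.lt ev
  have hI := hβ.mono ht₁.1.le ht₁.2 le_rfl
  have hs₁ : s ∈ Icc t₁ s := right_mem_Icc.2 ht₁.2.le
  have hcd := m.weak.contDiffOn hI fun t ht => (hQ₁ t ht).1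
  have hdc : ContinuousOn (derivWithin (m.e ∘ β) (Icc t₁ s)) (Icc t₁ s) :=
    hcd.continuousOn_derivWithin (uniqueDiffOn_Icc ht₁.2) (by simp)
  set u := m.e (β s) with hu
  set v := derivWithin (m.e ∘ β) (Icc t₁ s) s with hv
  have hvK : v ∈ weakCone (m.h u) m.ξ := m.weak.derivWithin_mem hI hs₁ m.mem_source m.mem_B
  -- Half of the margin at the end point, so that `h w ξ < -μ` persists for nearby base points and
  -- velocities.
  set μ := -(m.h u v m.ξ) / 2 with hμ
  have hμ0 : 0 < μ := by have := hvK.2; rw [hμ]; linarith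
  obtain ⟨L, V, hV, hL⟩ := (m.contDiffOn.contDiffAt
    (m.strict.isOpen.mem_nhds m.mem_B)).exists_lipschitzOnWith
  obtain ⟨δ, hδ, hball⟩ : ∃ δ > 0, ∀ y w, y ∈ Metric.ball u δ → w ∈ Metric.ball v δ →
      (y ∈ m.B ∧ y ∈ V) ∧ m.h y w m.ξ < -μ ∧ ‖w‖ < ‖v‖ + 1 := by
    have e1 : ∀ᶠ p : EuclideanSpace ℝ (Fin n) × EuclideanSpace ℝ (Fin n) in 𝓝 (u, v),
        p.1 ∈ m.B ∧ p.1 ∈ V := continuousAt_fst.eventually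
          (Filter.inter_mem (m.strict.isOpen.mem_nhds m.mem_B) hV)
    have e2 : ∀ᶠ p : EuclideanSpace ℝ (Fin n) × EuclideanSpace ℝ (Fin n) in 𝓝 (u, v),
        m.h p.1 p.2 m.ξ < -μ :=
      ((m.continuousAt_h_apply m.mem_B).clm_apply continuousAt_const).eventually_lt
        continuousAt_const (by show m.h u v m.ξ < -μ; linarith)
    have e3 : ∀ᶠ p : EuclideanSpace ℝ (Fin n) × EuclideanSpace ℝ (Fin n) in 𝓝 (u, v),
        ‖p.2‖ < ‖v‖ + 1 :=
      (continuousAt_snd.norm).eventually_lt continuousAt_const (by show ‖v‖ < ‖v‖ + 1; linarith)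
    obtain ⟨δ, hδ, hsub⟩ := Metric.eventually_nhds_iff_ball.1 (e1.and (e2.and e3))
    refine ⟨δ, hδ, fun y w hy hw => hsub (y, w) ?_⟩
    rw [← ball_prod_same]
    exact ⟨hy, hw⟩
  set b := ‖v‖ + 1 with hb
  have hb0 : 0 < b := by positivity
  have ev1 : ∀ᶠ t in 𝓝[Icc t₁ s] s, (m.e ∘ β) t ∈ Metric.ball u (δ / 2) :=
    hcd.continuousOn s hs₁ (Metric.ball_mem_nhds _ (half_pos hδ))
  have ev2 : ∀ᶠ t in 𝓝[Icc t₁ s] s, derivWithin (m.e ∘ β) (Icc t₁ s) t ∈ Metric.ball v δ :=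
    hdc s hs₁ (Metric.ball_mem_nhds _ hδ)
  have ev3 : ∀ᶠ t in 𝓝[Icc t₁ s] s, (s - t) * ‖m.ξ‖ < δ / 2 := by
    have : ContinuousAt (fun t => (s - t) * ‖m.ξ‖) s := by fun_prop
    exact (this.eventually_lt continuousAt_const (by simpa using half_pos hδ)).filter_mono
      nhdsWithin_le_nhds
  -- The loss from displacing the base point and the gain from tilting are both linear in `ε`.
  -- Dividing by `ε` leaves this condition, which holds near `s` uniformly in `ε`.
  have ev4 : ∀ᶠ t in 𝓝[Icc t₁ s] s, L * ((s - t) * ‖m.ξ‖) * b * b < 2 * μ := by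
    have : ContinuousAt (fun t => L * ((s - t) * ‖m.ξ‖) * b * b) s := by fun_prop
    exact (this.eventually_lt continuousAt_const (by simpa using hμ0)).filter_mono
      nhdsWithin_le_nhds
  obtain ⟨c₀, hc₀, hQ⟩ := exists_Icc_of_eventually_nhdsWithin ht₁.2
    (ev1.and (ev2.and (ev3.and ev4)))
  refine ⟨c₀, ⟨(ht₁.1.trans hc₀.1).le, hc₀.2⟩, fun c hc hcS => ?_⟩
  -- The tilt vanishes at `s`, so the end stays fixed, and it adds the timelike vector `ε • ξ` to
  -- every velocity.
  let γ : ℝ → ℝ → EuclideanSpace ℝ (Fin n) := fun ε t => (m.e ∘ β) t + (ε * (t - s)) • m.ξ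
  have hcB : c ∈ Icc t₁ s := ⟨(hc₀.1.trans hc.1).le, hc.2.le⟩
  have hnear : ∀ ε ∈ Icc (0 : ℝ) 1, ∀ t ∈ Icc c s, dist (γ ε t) ((m.e ∘ β) t) < δ / 2 := by
    intro ε hε t ht
    obtain ⟨-, -, h3, -⟩ := hQ t ⟨hc.1.le.trans ht.1, ht.2⟩
    have hts : 0 ≤ s - t := sub_nonneg.2 ht.2
    rw [dist_eq_norm, add_sub_cancel_left, norm_smul, Real.norm_eq_abs, abs_mul,
      abs_of_nonneg hε.1, abs_sub_comm, abs_of_nonneg hts]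
    refine lt_of_le_of_lt ?_ h3
    gcongr
    exact mul_le_of_le_one_left hts hε.2
  have hγball : ∀ ε ∈ Icc (0 : ℝ) 1, ∀ t ∈ Icc c s, γ ε t ∈ Metric.ball u δ := by
    intro ε hε t ht
    have h1 := (hQ t ⟨hc.1.le.trans ht.1, ht.2⟩).1
    have h2 := hnear ε hε t ht
    rw [Metric.mem_ball] at h1 ⊢
    linarith [dist_triangle (γ ε t) ((m.e ∘ β) t) u]
  have hseg : ∀ ε ∈ Ioc (0 : ℝ) 1, Seg W (m.e.symm (γ ε c)) (β s) := by
    intro ε hε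
    have hε' : ε ∈ Icc (0 : ℝ) 1 := ⟨hε.1.le, hε.2⟩
    have hlin : ContDiff ℝ ∞ fun t : ℝ => (ε * (t - s)) • m.ξ :=
      (contDiff_const.mul (contDiff_id.sub contDiff_const)).smul contDiff_const
    have hI' : IsSmoothIn W (m.e.symm ∘ γ ε) c s := by
      refine m.strict.isSmoothIn_symm hc.2
        ((hcd.mono (Icc_subset_Icc hcB.1 le_rfl)).add hlin.contDiffOn)
        (fun t ht => (hball _ v (hγball ε hε' t ht) (Metric.mem_ball_self hδ)).1.1)
        fun t ht => ?_
      have ht₁' : t ∈ Icc t₁ s := ⟨hcB.1.trans ht.1, ht.2⟩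
      obtain ⟨h1, h2, h3, h4⟩ := hQ t ⟨hc.1.le.trans ht.1, ht.2⟩
      set w := derivWithin (m.e ∘ β) (Icc t₁ s) t with hw
      have hd1 : HasDerivWithinAt (m.e ∘ β) w (Icc c s) t :=
        ((hcd.differentiableOn (by simp) t ht₁').hasDerivWithinAt).mono
          (Icc_subset_Icc hcB.1 le_rfl)
      have hd2 : HasDerivAt (fun t : ℝ => (ε * (t - s)) • m.ξ) (ε • m.ξ) t := by
        simpa using (((hasDerivAt_id t).sub_const s).const_mul ε).smul_const m.ξ
      have hd : HasDerivWithinAt (γ ε) (w + ε • m.ξ) (Icc c s) t := hd1.add hd2.hasDerivWithinAt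
      rw [hd.derivWithin (uniqueDiffOn_Icc hc.2 t ht)]
      have hwK : w ∈ weakCone (m.h ((m.e ∘ β) t)) m.ξ :=
        m.weak.derivWithin_mem hI ht₁' (hQ₁ t ht₁').1 (hQ₁ t ht₁').2
      obtain ⟨⟨hyB, hyV⟩, hyξ, hwb⟩ := hball _ w (hγball ε hε' t ht) h2
      obtain ⟨⟨-, hxV⟩, -, -⟩ := hball _ w (Metric.ball_subset_ball (half_le_self hδ.le) h1) h2
      have hξξ := m.timelike _ hyB
      have hsym := m.symm _ hyB m.ξ w
      have hts : 0 ≤ s - t := sub_nonneg.2 ht.2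
      have hnorm : ‖γ ε t - (m.e ∘ β) t‖ = ε * ((s - t) * ‖m.ξ‖) := by
        rw [add_sub_cancel_left, norm_smul, Real.norm_eq_abs, abs_mul,
          abs_of_nonneg hε'.1, abs_sub_comm, abs_of_nonneg hts, mul_assoc]
      have hdiff : m.h (γ ε t) w w - m.h ((m.e ∘ β) t) w w ≤
          ε * (L * ((s - t) * ‖m.ξ‖) * b * b) := by
        refine (apply_sub_apply_le_of_lipschitzOnWith hL hxV hyV w).trans ?_
        rw [hnorm]
        calc _ ≤ L * (ε * ((s - t) * ‖m.ξ‖)) * b * b := by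
              have := hε'.1
              gcongr
          _ = _ := by ring
      have hww := hwK.1
      have hε0 := hε.1
      constructor
      · have h7 : m.h (γ ε t) (w + ε • m.ξ) (w + ε • m.ξ) = m.h (γ ε t) w w +
            2 * ε * m.h (γ ε t) w m.ξ + ε ^ 2 * m.h (γ ε t) m.ξ m.ξ := by
          simp only [map_add, map_smul, add_apply, smul_apply, smul_eq_mul]
          rw [hsym]; ring
        rw [h7]
        -- The original square is at most `0`, the displacement adds less than `2εμ`, the cross term
        -- is below `-2εμ`, and the `ε²` term is negative.
        nlinarith [mul_lt_mul_of_pos_left h4 hε0, mul_lt_mul_of_pos_left hyξ hε0,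
          mul_neg_of_pos_of_neg (pow_pos hε0 2) hξξ]
      · have h7 : m.h (γ ε t) (w + ε • m.ξ) m.ξ =
            m.h (γ ε t) w m.ξ + ε * m.h (γ ε t) m.ξ m.ξ := by simp
        change m.h (γ ε t) (w + ε • m.ξ) m.ξ < 0
        rw [h7]
        nlinarith [mul_neg_of_pos_of_neg hε0 hξξ]
    have h8 := hI'.seg
    have h9 : (m.e.symm ∘ γ ε) s = β s := by simp [γ, m.e.left_inv m.mem_source]
    rwa [h9] at h8
  have hlim : Filter.Tendsto (fun ε => m.e.symm (γ ε c)) (𝓝[>] 0) (𝓝 (β c)) := by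
    have h1 : Continuous fun ε => γ ε c := by fun_prop
    have h2 : Filter.Tendsto (fun ε => γ ε c) (𝓝[>] 0) (𝓝 (m.e (β c))) := by
      have := (h1.tendsto 0).mono_left (nhdsWithin_le_nhds (s := Ioi 0))
      simpa [γ] using this
    have h3 := (hQ₁ c hcB).1
    have h4 := (m.e.symm.continuousAt (m.e.map_source h3)).tendsto.comp h2
    rwa [m.e.left_inv h3] at h4
  -- As `ε` tends to `0` the start of the tilted curve tends to `β c`, hence enters the open set
  -- `S`.
  obtain ⟨ε, hεS, hε⟩ := ((hlim.eventually (hS.mem_nhds hcS)).and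
    (Ioc_mem_nhdsGT (zero_lt_one' ℝ))).exists
  exact ⟨_, hεS, hseg ε hε⟩

end LocalModel

/-- The cone fields `W` and `J` have local models everywhere. -/
def HasLocalModels (F : Foliation ι n q M) (W J : ∀ x : M, Set (TangentSpace (𝓡 n) x)) : Prop :=
  ∀ i, ∀ p ∈ F.U i, Nonempty (LocalModel F W J i p)

/-! ### Openness of timelike reachability and push-up on the manifold. -/

namespace HasLocalModels

variable {x y z y₁ y₂ : M} (hm : HasLocalModels F W J)

include hm

theorem reverse : HasLocalModels F (reverse W) (reverse J) :=
  fun i p hp => (hm i p hp).map LocalModel.reverse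

theorem exists_model (p : M) : ∃ i, Nonempty (LocalModel F W J i p) :=
  (F.cover p).imp fun i hi => hm i p hi

theorem isOpen_setOf_reach (x : M) : IsOpen {y | Reach W x y} := by
  rw [isOpen_iff_mem_nhds]
  intro y hy
  obtain ⟨w, hxw, hwy⟩ := Relation.TransGen.tail'_iff.1 hy
  obtain ⟨i, ⟨m⟩⟩ := hm.exists_model y
  filter_upwards [m.eventually_reach hwy] with y' hy'
  exact Relation.TransGen.trans_right hxw hy'

theorem mem_closure_setOf_seg (x : M) : x ∈ closure {y | Seg W x y} := by
  obtain ⟨i, ⟨m⟩⟩ := hm.exists_model x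
  exact mem_closure_iff_frequently.2 m.frequently_seg

/-- Otherwise there is a first parameter `s` at which the causal curve is outside the open future of
`x`. Tilting the piece just before `s` gives a timelike segment that starts inside this future and
ends at `β s`, a contradiction. -/
theorem reach_of_seg (hxy : Reach W x y) (hyz : Seg J y z) : Reach W x z := by
  obtain ⟨β, a, b, hβ, rfl, rfl⟩ := hyz
  have hS := hm.isOpen_setOf_reach x
  by_contra hcon
  have hclosed : IsClosed (Icc a b ∩ β ⁻¹' {y | Reach W x y}ᶜ) :=
    hβ.continuousOn.preimage_isClosed_of_isClosed isClosed_Icc hS.isClosed_compl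
  have hcomp : IsCompact (Icc a b ∩ β ⁻¹' {y | Reach W x y}ᶜ) :=
    isCompact_Icc.of_isClosed_subset hclosed inter_subset_left
  obtain ⟨s, ⟨hs, hsS⟩, hleast⟩ := hcomp.exists_isLeast ⟨b, right_mem_Icc.2 hβ.lt.le, hcon⟩
  have has : a < s := lt_of_le_of_ne hs.1 fun h => hsS (by rw [← h]; exact hxy)
  obtain ⟨i, ⟨m⟩⟩ := hm.exists_model (β s)
  obtain ⟨c₀, hc₀, hc⟩ := m.exists_seg_of_causal (hβ.mono le_rfl has hs.2) hS
  obtain ⟨c, hcI⟩ := exists_between hc₀.2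
  have hcS : Reach W x (β c) := by
    by_contra hcn
    have : s ≤ c := hleast ⟨⟨(hc₀.1.trans_lt hcI.1).le, hcI.2.le.trans hs.2⟩, hcn⟩
    exact absurd hcI.2 (not_lt.2 this)
  obtain ⟨w, hw, hws⟩ := hc c hcI hcS
  exact hsS (Relation.TransGen.tail hw hws)

theorem reach_of_reach (hxy : Reach W x y) (hyz : Reach J y z) : Reach W x z := by
  induction hyz with
  | single h => exact hm.reach_of_seg hxy h
  | tail _ h ih => exact hm.reach_of_seg ih h

end HasLocalModels

/-- An equivalence relation that relates any two points of a small plaque is coarser than the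
relation of lying on the same leaf. -/
theorem leaf_rel_of_local (F : Foliation ι n q M) {r : M → M → Prop} (hr : Equivalence r)
    (hloc : ∀ i, ∀ p ∈ F.U i, ∀ᶠ y in 𝓝 p, F.proj i p = F.proj i y → r p y) {x y : M}
    (hxy : F.leaf x = F.leaf y) : r x y := by
  have hplaque : ∀ x y, F.SamePlaque x y → r x y := by
    rintro x y ⟨i, hx, hy⟩
    have hsub := connectedComponentIn_subset (F.U i ∩ F.proj i ⁻¹' {F.proj i x}) x
    -- A relation that is locally trivial on a connected plaque relates all its points.
    refine (isPreconnected_connectedComponentIn (F := F.U i ∩ F.proj i ⁻¹' {F.proj i x})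
      (x := x)).induction₂ r (fun p hp => ?_) (fun _ _ _ _ _ _ => hr.trans)
      (fun _ _ _ _ => hr.symm) (mem_connectedComponentIn ⟨hx, rfl⟩) hy
    filter_upwards [nhdsWithin_le_nhds (hloc i p (hsub hp).1), self_mem_nhdsWithin] with y' h1 hy'
    exact h1 ((hsub hp).2.trans (hsub hy').2.symm)
  have h : Relation.EqvGen F.SamePlaque x y := Quotient.exact hxy
  clear hxy
  induction h with
  | rel x y h => exact hplaque x y h
  | refl x => exact hr.refl x
  | symm x y _ ih => exact hr.symm ih
  | trans x y z _ _ ih₁ ih₂ => exact hr.trans ih₁ ih₂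

/-! ### Independence of reachability from the chosen points of the leaves. -/

namespace HasLocalModels

variable {x y z x₁ x₂ y₁ y₂ : M} (hm : HasLocalModels F W J)

/-- Having the same set of points from which it is reached is an equivalence relation on end points;
local sliding makes it constant on small plaques, hence on leaves. -/
theorem reach_iff_of_leaf_eq_aux {C : ∀ x : M, Set (TangentSpace (𝓡 n) x)}
    (hslide : ∀ i, ∀ p ∈ F.U i, ∃ N ∈ 𝓝 p, ∀ y₁ ∈ N, ∀ y₂ ∈ N, F.proj i y₁ = F.proj i y₂ →
      ∀ x, Seg C x y₁ → Reach C x y₂) (hy : F.leaf y₁ = F.leaf y₂) :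
    Reach C x y₁ ↔ Reach C x y₂ := by
  have hr : Equivalence fun y₁ y₂ => ∀ x, Reach C x y₁ ↔ Reach C x y₂ :=
    ⟨fun _ _ => Iff.rfl, fun h x => (h x).symm, fun h h' x => (h x).trans (h' x)⟩
  refine leaf_rel_of_local F hr (fun i p hp => ?_) hy x
  obtain ⟨N, hN, h⟩ := hslide i p hp
  have key : ∀ y₁ ∈ N, ∀ y₂ ∈ N, F.proj i y₁ = F.proj i y₂ → ∀ x, Reach C x y₁ → Reach C x y₂ := by
    intro y₁ h₁ y₂ h₂ hpr x hx
    obtain ⟨w, hxw, hwy⟩ := Relation.TransGen.tail'_iff.1 hx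
    exact Relation.TransGen.trans_right hxw (h y₁ h₁ y₂ h₂ hpr w hwy)
  filter_upwards [hN] with y hy hpr x
  exact ⟨key p (mem_of_mem_nhds hN) y hy hpr x, key y hy p (mem_of_mem_nhds hN) hpr.symm x⟩

include hm

theorem reach_strict_iff_of_leaf_eq_right (hy : F.leaf y₁ = F.leaf y₂) :
    Reach W x y₁ ↔ Reach W x y₂ :=
  reach_iff_of_leaf_eq_aux (fun i p hp => by
    obtain ⟨m⟩ := hm i p hp
    exact ⟨_, m.eventually_mem, fun y₁ h₁ y₂ h₂ hpr x => m.reach_slide_strict h₁ h₂ hpr⟩) hy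

theorem reach_weak_iff_of_leaf_eq_right (hy : F.leaf y₁ = F.leaf y₂) :
    Reach J x y₁ ↔ Reach J x y₂ :=
  reach_iff_of_leaf_eq_aux (fun i p hp => by
    obtain ⟨m⟩ := hm i p hp
    exact ⟨_, m.eventually_mem, fun y₁ h₁ y₂ h₂ hpr x => m.reach_slide_weak h₁ h₂ hpr⟩) hy

theorem reach_strict_iff_of_leaf_eq (hx : F.leaf x₁ = F.leaf x₂) (hy : F.leaf y₁ = F.leaf y₂) :
    Reach W x₁ y₁ ↔ Reach W x₂ y₂ := by
  rw [hm.reach_strict_iff_of_leaf_eq_right hy, ← reach_reverse_iff,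
    hm.reverse.reach_strict_iff_of_leaf_eq_right hx, reach_reverse_iff]

theorem reach_weak_iff_of_leaf_eq (hx : F.leaf x₁ = F.leaf x₂) (hy : F.leaf y₁ = F.leaf y₂) :
    Reach J x₁ y₁ ↔ Reach J x₂ y₂ := by
  rw [hm.reach_weak_iff_of_leaf_eq_right hy, ← reach_reverse_iff,
    hm.reverse.reach_weak_iff_of_leaf_eq_right hx, reach_reverse_iff]

end HasLocalModels

end LorentzFoliation
end

/-! ### Coordinate vector fields and the coordinate form of the metric. -/

noncomputable section

namespace LorentzFoliation

variable {ι : Type*} {n q : ℕ} {M : Type*} [TopologicalSpace M]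
  [ChartedSpace (EuclideanSpace ℝ (Fin n)) M] [IsManifold (𝓡 n) ∞ M]
  {F : Foliation ι n q M}
  {e : OpenPartialHomeomorph M (EuclideanSpace ℝ (Fin n))} {x : M}

/-- The constant vector field `z` on the model space. -/
def constField (z : EuclideanSpace ℝ (Fin n)) (u : EuclideanSpace ℝ (Fin n)) :
    TangentSpace (𝓡 n) u := z

/-- The vector field with constant coordinates `z` in the chart `e`. -/
def coordField (e : OpenPartialHomeomorph M (EuclideanSpace ℝ (Fin n)))
    (z : EuclideanSpace ℝ (Fin n)) : ∀ x : M, TangentSpace (𝓡 n) x :=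
  VectorField.mpullback (𝓡 n) (𝓡 n) e (constField z)

theorem contMDiffAt_constField (z u : EuclideanSpace ℝ (Fin n)) :
    ContMDiffAt (𝓡 n) (𝓡 n).tangent ∞
      (fun y => (⟨y, constField z y⟩ : TangentBundle (𝓡 n) (EuclideanSpace ℝ (Fin n)))) u :=
  contMDiffAt_vectorSpace_iff_contDiffAt.2 contDiffAt_const

theorem mlieBracket_constField (z w u : EuclideanSpace ℝ (Fin n)) :
    VectorField.mlieBracket (𝓡 n) (constField z) (constField w) u = 0 := by
  rw [← VectorField.mlieBracketWithin_univ]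
  refine (congrFun VectorField.mlieBracketWithin_eq_lieBracketWithin u).trans ?_
  have hc : ∀ z : EuclideanSpace ℝ (Fin n), fderivWithin ℝ
      (fun _ : EuclideanSpace ℝ (Fin n) => z) univ u = 0 := fun z => by simp
  have h : VectorField.lieBracketWithin ℝ (fun _ : EuclideanSpace ℝ (Fin n) => z)
      (fun _ => w) univ u = 0 := by
    rw [VectorField.lieBracketWithin, hc, hc]
    simp
  exact h

section

variable (he : e ∈ IsManifold.maximalAtlas (𝓡 n) ∞ M)

include he

omit [IsManifold (𝓡 n) ∞ M] in
theorem isInvertible_mfderiv_chart (hx : x ∈ e.source) :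
    (mfderiv (𝓡 n) (𝓡 n) e x).IsInvertible := by
  have h : e.MDifferentiable (𝓡 n) (𝓡 n) :=
    ⟨(contMDiffOn_of_mem_maximalAtlas he).mdifferentiableOn (by simp),
      (contMDiffOn_symm_of_mem_maximalAtlas he).mdifferentiableOn (by simp)⟩
  exact ⟨h.mfderiv hx, rfl⟩

omit [IsManifold (𝓡 n) ∞ M] in
theorem mfderiv_coordField (hx : x ∈ e.source) (z : EuclideanSpace ℝ (Fin n)) :
    mfderiv (𝓡 n) (𝓡 n) e x (coordField e z x) = constField z (e x) := by
  obtain ⟨L, hL⟩ := isInvertible_mfderiv_chart he hx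
  rw [coordField, VectorField.mpullback_apply, ← hL, ContinuousLinearMap.inverse_equiv]
  exact L.apply_symm_apply _

omit [IsManifold (𝓡 n) ∞ M] in
theorem coordField_mfderiv (hx : x ∈ e.source) (v : TangentSpace (𝓡 n) x) :
    coordField e (mfderiv (𝓡 n) (𝓡 n) e x v : EuclideanSpace ℝ (Fin n)) x = v := by
  obtain ⟨L, hL⟩ := isInvertible_mfderiv_chart he hx
  change (mfderiv (𝓡 n) (𝓡 n) e x).inverse (mfderiv (𝓡 n) (𝓡 n) e x v) = v
  rw [← hL, ContinuousLinearMap.inverse_equiv]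
  exact L.symm_apply_apply v

theorem contMDiffAt_coordField (hx : x ∈ e.source) (z : EuclideanSpace ℝ (Fin n)) :
    ContMDiffAt (𝓡 n) (𝓡 n).tangent ∞
      (fun y => (⟨y, coordField e z y⟩ : TangentBundle (𝓡 n) M)) x :=
  ContMDiffAt.mpullback_vectorField_preimage (n := ∞) (contMDiffAt_constField z (e x))
    (contMDiffAt_of_mem_maximalAtlas he hx) (isInvertible_mfderiv_chart he hx) (by simp)

theorem smoothFieldOn_coordField (z : EuclideanSpace ℝ (Fin n)) :
    SmoothFieldOn (coordField e z : ∀ x : M, TangentSpace (𝓡 n) x) e.source :=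
  fun _ hx => (contMDiffAt_coordField he hx z).contMDiffWithinAt

/-- Brackets are natural under pullback, and constant fields commute. This reduces the Lie
derivative of the metric to a derivative of its coordinates. -/
theorem mlieBracket_coordField (hx : x ∈ e.source) (z w : EuclideanSpace ℝ (Fin n)) :
    VectorField.mlieBracket (𝓡 n) (coordField e z) (coordField e w) x = 0 := by
  have h2 : minSmoothness ℝ 2 ≤ (∞ : WithTop ℕ∞) := by
    rw [minSmoothness_of_isRCLikeNormedField]
    exact WithTop.coe_le_coe.2 (le_top : (2 : ℕ∞) ≤ ⊤)
  have : IsManifold (𝓡 n) (minSmoothness ℝ 2) M :=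
    IsManifold.of_le (n := ∞) h2
  have h := VectorField.mpullback_mlieBracket (I := 𝓡 n) (I' := 𝓡 n) (n := ∞) (f := e) (x₀ := x)
    ((contMDiffAt_constField z (e x)).mdifferentiableAt (by simp))
    ((contMDiffAt_constField w (e x)).mdifferentiableAt (by simp))
    (contMDiffAt_of_mem_maximalAtlas he hx)
    h2
  refine h.symm.trans ?_
  rw [VectorField.mpullback_apply, mlieBracket_constField]
  exact map_zero _

omit [IsManifold (𝓡 n) ∞ M] in
theorem mvfderiv_coordField {V : Type*} [NormedAddCommGroup V] [NormedSpace ℝ V] {f : M → V}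
    (hf : MDifferentiableAt (𝓡 n) 𝓘(ℝ, V) f x) (hx : x ∈ e.source)
    (z : EuclideanSpace ℝ (Fin n)) :
    mvfderiv (𝓡 n) f x (coordField e z x) = fderiv ℝ (f ∘ e.symm) (e x) z := by
  have hs : MDifferentiableAt (𝓡 n) (𝓡 n) e.symm (e x) :=
    (contMDiffAt_symm_of_mem_maximalAtlas he (e.map_source hx)).mdifferentiableAt (by simp)
  have hf' : MDifferentiableAt (𝓡 n) 𝓘(ℝ, V) f (e.symm (e x)) := by rwa [e.left_inv hx]
  have h1 : DifferentiableAt ℝ (f ∘ e.symm) (e x) :=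
    mdifferentiableAt_iff_differentiableAt.1 (hf'.comp (e x) hs)
  have h2 : HasMFDerivAt (𝓡 n) 𝓘(ℝ, V) ((f ∘ e.symm) ∘ e) x
      ((fderiv ℝ (f ∘ e.symm) (e x)).comp (mfderiv (𝓡 n) (𝓡 n) e x)) :=
    h1.hasFDerivAt.hasMFDerivAt.comp x
      ((contMDiffAt_of_mem_maximalAtlas he hx).mdifferentiableAt (by simp)).hasMFDerivAt
  have h3 : f =ᶠ[𝓝 x] (f ∘ e.symm) ∘ e := by
    filter_upwards [e.open_source.mem_nhds hx] with y hy
    simp [e.left_inv hy]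
  have h4 := (h2.congr_of_eventuallyEq h3).mfderiv
  rw [mvfderiv, h4]
  exact congrArg (fderiv ℝ (f ∘ e.symm) (e x)) (mfderiv_coordField he hx z)

/-- Directions along which the submersions are constant are tangent to the foliation. -/
theorem coordField_mem_tangent (hx : x ∈ e.source) {z : EuclideanSpace ℝ (Fin n)} {i : ι}
    (hi : x ∈ F.U i) (hz : ∀ᶠ s in 𝓝 (0 : ℝ), F.proj i (e.symm (e x + s • z)) = F.proj i x) :
    coordField e z x ∈ F.tangent x := by
  simp only [Foliation.tangent, Submodule.mem_iInf]
  intro j hj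
  rw [LinearMap.mem_ker]
  have hd : MDifferentiableAt (𝓡 n) (𝓡 q) (F.proj j) x :=
    ((F.submersion j x hj).contMDiffAt).mdifferentiableAt (by simp)
  have hd' : MDifferentiableAt (𝓡 n) (𝓡 q) (F.proj j) (e.symm (e x)) := by rwa [e.left_inv hx]
  have hs : MDifferentiableAt (𝓡 n) (𝓡 n) e.symm (e x) :=
    (contMDiffAt_symm_of_mem_maximalAtlas he (e.map_source hx)).mdifferentiableAt (by simp)
  have h1 : DifferentiableAt ℝ (F.proj j ∘ e.symm) (e x) :=
    mdifferentiableAt_iff_differentiableAt.1 (hd'.comp (e x) hs)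
  change mvfderiv (𝓡 n) (F.proj j) x (coordField e z x) = 0
  rw [mvfderiv_coordField he hd hx, ← h1.lineDeriv_eq_fderiv]
  have hcont : ContinuousAt (fun s : ℝ => e.symm (e x + s • z)) 0 := by
    have h2 : ContinuousAt e.symm (e x + (0 : ℝ) • z) := by
      simpa using e.symm.continuousAt (e.map_source hx)
    exact ContinuousAt.comp (f := fun s : ℝ => e x + s • z) h2 (by fun_prop)
  have hU : ∀ᶠ s in 𝓝 (0 : ℝ), e.symm (e x + s • z) ∈ F.U i ∩ F.U j := by
    refine hcont (((F.isOpen_U i).inter (F.isOpen_U j)).mem_nhds ?_)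
    simpa [e.left_inv hx] using ⟨hi, hj⟩
  -- The tangent space is defined with all submersions at `x`; the transition map carries constancy
  -- of `proj i` along the line over to `proj j`.
  have hconst : (fun s : ℝ => (F.proj j ∘ e.symm) (e x + s • z)) =ᶠ[𝓝 0]
      fun _ => F.proj j x := by
    filter_upwards [hz, hU] with s h3 h4
    rw [Function.comp_apply, ← F.γ_comp j i _ h4.symm, h3, F.γ_comp j i x ⟨hj, hi⟩]
  rw [lineDeriv, hconst.deriv_eq]
  simp

end

/-- The coordinate expression of a transverse metric in the chart `e`. -/
def coordForm (G : TransverseLorentzMetric F)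
    (e : OpenPartialHomeomorph M (EuclideanSpace ℝ (Fin n))) (u : EuclideanSpace ℝ (Fin n)) :
    EuclideanSpace ℝ (Fin n) →L[ℝ] EuclideanSpace ℝ (Fin n) →L[ℝ] ℝ :=
  let B : EuclideanSpace ℝ (Fin n) →L[ℝ] EuclideanSpace ℝ (Fin n) →L[ℝ] ℝ := G.g (e.symm u)
  let L : EuclideanSpace ℝ (Fin n) →L[ℝ] EuclideanSpace ℝ (Fin n) :=
    (mfderiv (𝓡 n) (𝓡 n) e (e.symm u)).inverse
  B.bilinearComp L L

section

variable (G : TransverseLorentzMetric F)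

theorem contMDiffAt_g_apply {X Y : ∀ x : M, TangentSpace (𝓡 n) x}
    (hX : ContMDiffAt (𝓡 n) (𝓡 n).tangent ∞ (fun y => (⟨y, X y⟩ : TangentBundle (𝓡 n) M)) x)
    (hY : ContMDiffAt (𝓡 n) (𝓡 n).tangent ∞ (fun y => (⟨y, Y y⟩ : TangentBundle (𝓡 n) M)) x) :
    ContMDiffAt (𝓡 n) 𝓘(ℝ, ℝ) ∞ (fun y => G.g y (X y) (Y y)) x := by
  have h := ContMDiffAt.clm_bundle_apply₂ (E₃ := fun _ : M => ℝ) (F₃ := ℝ)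
    (G.smooth x) hX hY
  rw [Bundle.contMDiffAt_section] at h
  exact h

theorem coordForm_apply (u v w : EuclideanSpace ℝ (Fin n)) : coordForm G e u v w =
    G.g (e.symm u) (coordField e v (e.symm u)) (coordField e w (e.symm u)) := rfl

variable (he : e ∈ IsManifold.maximalAtlas (𝓡 n) ∞ M)

include he

theorem coordForm_mfderiv (hx : x ∈ e.source) (v w : TangentSpace (𝓡 n) x) :
    coordForm G e (e x) (mfderiv (𝓡 n) (𝓡 n) e x v : EuclideanSpace ℝ (Fin n))
      (mfderiv (𝓡 n) (𝓡 n) e x w : EuclideanSpace ℝ (Fin n)) = G.g x v w := by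
  have key : ∀ y : M, y = x → G.g y
      (coordField e (mfderiv (𝓡 n) (𝓡 n) e x v : EuclideanSpace ℝ (Fin n)) y)
      (coordField e (mfderiv (𝓡 n) (𝓡 n) e x w : EuclideanSpace ℝ (Fin n)) y) = G.g x v w := by
    rintro y rfl
    rw [coordField_mfderiv he hx, coordField_mfderiv he hx]
  exact key _ (e.left_inv hx)

/-- In finite dimension it is enough to check the matrix entries. Order one suffices, as only
continuity, local Lipschitz bounds and first derivatives are used. -/
theorem contDiffOn_coordForm : ContDiffOn ℝ 1 (coordForm G e) e.target := by
  have key : ∀ v w, ContDiffOn ℝ 1 (fun u => coordForm G e u v w) e.target := by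
    intro v w u hu
    have h1 : ContMDiffAt (𝓡 n) 𝓘(ℝ, ℝ) ∞ (fun y => G.g y (coordField e v y) (coordField e w y))
        (e.symm u) := contMDiffAt_g_apply G
      (contMDiffAt_coordField he (e.map_target hu) v) (contMDiffAt_coordField he (e.map_target hu) w)
    have h2 := h1.comp u (contMDiffAt_symm_of_mem_maximalAtlas he hu)
    exact ((contMDiffAt_iff_contDiffAt.1 h2).of_le (by simp)).contDiffWithinAt
  exact contDiffOn_clm_apply.2 fun v => contDiffOn_clm_apply.2 fun w => key v w

end

end LorentzFoliation
end

/-! ### Construction of the local models. -/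

noncomputable section

namespace LorentzFoliation

variable {ι : Type*} {n q : ℕ} {M : Type*} [TopologicalSpace M]
  [ChartedSpace (EuclideanSpace ℝ (Fin n)) M] [IsManifold (𝓡 n) ∞ M]
  {F : Foliation ι n q M} {e : OpenPartialHomeomorph M (EuclideanSpace ℝ (Fin n))} {x : M}

section

variable (G : TransverseLorentzMetric F) (he : e ∈ IsManifold.maximalAtlas (𝓡 n) ∞ M)

theorem coordForm_chart (hx : x ∈ e.source) (v w : EuclideanSpace ℝ (Fin n)) :
    coordForm G e (e x) v w = G.g x (coordField e v x) (coordField e w x) := by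
  rw [coordForm_apply, e.left_inv hx]

include he

theorem coordForm_mfderiv_right (hx : x ∈ e.source) (v : TangentSpace (𝓡 n) x)
    (z : EuclideanSpace ℝ (Fin n)) :
    coordForm G e (e x) (mfderiv (𝓡 n) (𝓡 n) e x v : EuclideanSpace ℝ (Fin n)) z =
      G.g x v (coordField e z x) := by
  refine (coordForm_chart G hx _ _).trans ?_
  rw [coordField_mfderiv he hx]

/-- The coordinate expression of the metric has vanishing derivative along the leaves. -/
theorem fderiv_coordForm_eq_zero {O : Set M} (hO : IsOpen O) (hOe : O ⊆ e.source)
    {z : EuclideanSpace ℝ (Fin n)} (hz : ∀ y ∈ O, coordField e z y ∈ F.tangent y) (hx : x ∈ O)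
    (v w : EuclideanSpace ℝ (Fin n)) :
    fderiv ℝ (fun u => coordForm G e u v w) (e x) z = 0 := by
  have hs : ∀ z : EuclideanSpace ℝ (Fin n),
      SmoothFieldOn (coordField e z : ∀ x : M, TangentSpace (𝓡 n) x) O := fun z =>
    (smoothFieldOn_coordField he z).mono hOe
  have h := G.basic.lie O hO (coordField e z) (coordField e v) (coordField e w) (hs z) (hs v) (hs w)
    hz x hx
  have hxs := hOe hx
  rw [lieDeriv, mlieBracket_coordField he hxs, mlieBracket_coordField he hxs] at h
  simp only [map_zero, zero_apply, sub_zero] at h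
  have hd := (contMDiffAt_g_apply G (contMDiffAt_coordField he hxs v)
    (contMDiffAt_coordField he hxs w)).mdifferentiableAt (by simp)
  rw [mvfderiv_coordField he hd hxs] at h
  exact h

/-- The coordinate expression of the metric is constant along segments in leaf directions. -/
theorem coordForm_eq_of_segment {B : Set (EuclideanSpace ℝ (Fin n))} (hB : IsOpen B)
    (hBc : Convex ℝ B) (hBt : B ⊆ e.target) {z : EuclideanSpace ℝ (Fin n)}
    (hz : ∀ u ∈ B, coordField e z (e.symm u) ∈ F.tangent (e.symm u))
    {u : EuclideanSpace ℝ (Fin n)} (hu : u ∈ B) (huz : u + z ∈ B) :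
    coordForm G e (u + z) = coordForm G e u := by
  ext v w
  have hline : ∀ s ∈ Icc (0 : ℝ) 1, u + s • z ∈ B := fun s hs => hBc.add_smul_mem hu huz hs
  have hO : IsOpen (e.source ∩ e ⁻¹' B) := e.isOpen_inter_preimage hB
  have hd : ∀ s ∈ Icc (0 : ℝ) 1,
      HasDerivAt (fun s : ℝ => coordForm G e (u + s • z) v w) 0 s := by
    intro s hs
    have ht := hBt (hline s hs)
    have h0 := fderiv_coordForm_eq_zero G he hO inter_subset_left (z := z) (x := e.symm (u + s • z))
      (fun y hy => by
        have := hz (e y) hy.2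
        rwa [e.left_inv hy.1] at this)
      ⟨e.map_target ht, by simpa [e.right_inv ht] using hline s hs⟩ v w
    rw [e.right_inv ht] at h0
    have hdiff : DifferentiableAt ℝ (coordForm G e) (u + s • z) :=
      ((contDiffOn_coordForm G he).contDiffAt (e.open_target.mem_nhds ht)).differentiableAt
        (by simp)
    have hdiff' : DifferentiableAt ℝ (fun u => coordForm G e u v w) (u + s • z) :=
      (hdiff.clm_apply (differentiableAt_const v)).clm_apply (differentiableAt_const w)
    have hl : HasDerivAt (fun s : ℝ => u + s • z) z s := by
      simpa using ((hasDerivAt_id s).smul_const z).const_add u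
    have := hdiff'.hasFDerivAt.comp_hasDerivAt s hl
    rwa [h0] at this
  have hconst := constant_of_has_deriv_right_zero
    (fun s hs => (hd s hs).continuousAt.continuousWithinAt)
    (fun s hs => (hd s ⟨hs.1, hs.2.le⟩).hasDerivWithinAt) 1 (right_mem_Icc.2 zero_le_one)
  simpa using hconst

end

/-- The normal form of a submersion provides the chart and `P`. The vector `ξ` has the coordinates
at `p` of a smooth future field `X`; by continuity it remains timelike and on the side of `X` over a
small ball, so it describes the wedges there. -/
theorem TimeOrientation.hasLocalModels {G : TransverseLorentzMetric F} (T : TimeOrientation G) :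
    HasLocalModels F T.wedge T.causalWedge := by
  intro i p hp
  have hs := F.submersion i p hp
  obtain ⟨U, hU, hpU, X, hX, hXW⟩ := T.smooth p
  set e := hs.domChart
  have he : e ∈ IsManifold.maximalAtlas (𝓡 n) ∞ M := hs.domChart_mem_maximalAtlas
  have hpe : p ∈ e.source := hs.mem_domChart_source
  let P : EuclideanSpace ℝ (Fin n) →L[ℝ] EuclideanSpace ℝ (Fin q) :=
    (ContinuousLinearMap.fst ℝ (EuclideanSpace ℝ (Fin q)) hs.complement).comp
      (hs.equiv : EuclideanSpace ℝ (Fin n) →L[ℝ] EuclideanSpace ℝ (Fin q) × hs.complement)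
  have hP : ∀ x ∈ e.source, hs.codChart (F.proj i x) = P (e x) := by
    intro x hx
    have hmem : e x ∈ (hs.domChart.extend (𝓡 n)).target := by
      simpa using e.map_source hx
    have := hs.writtenInCharts hmem
    have h : hs.codChart (F.proj i x) = (hs.equiv (e x)).1 := by
      simpa [e, hs.domChart.left_inv hx] using this
    exact h
  have hcod : ∀ x ∈ e.source, F.proj i x ∈ hs.codChart.source := fun x hx =>
    hs.source_subset_preimage_source hx
  let ξ : EuclideanSpace ℝ (Fin n) := mfderiv (𝓡 n) (𝓡 n) e p (X p)
  have hξp : coordField e ξ p = X p := coordField_mfderiv he hpe (X p)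
  have hXp := T.timelike_of_mem_wedge (hXW p hpU)
  have ev : ∀ᶠ x in 𝓝 p, (x ∈ F.U i ∧ x ∈ U) ∧
      G.g x (coordField e ξ x) (coordField e ξ x) < 0 ∧ G.g x (coordField e ξ x) (X x) < 0 := by
    have hξs := contMDiffAt_coordField he hpe ξ
    have hXs := (hX p hpU).contMDiffAt (hU.mem_nhds hpU)
    refine (((F.isOpen_U i).eventually_mem hp).and (hU.eventually_mem hpU)).and
      (((contMDiffAt_g_apply G hξs hξs).continuousAt.eventually_lt continuousAt_const ?_).and
        ((contMDiffAt_g_apply G hξs hXs).continuousAt.eventually_lt continuousAt_const ?_)) <;>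
    simpa only [hξp] using hXp
  have ev' : ∀ᶠ u in 𝓝 (e p), u ∈ e.target ∧ ((e.symm u ∈ F.U i ∧ e.symm u ∈ U) ∧
      G.g (e.symm u) (coordField e ξ (e.symm u)) (coordField e ξ (e.symm u)) < 0 ∧
      G.g (e.symm u) (coordField e ξ (e.symm u)) (X (e.symm u)) < 0) := by
    refine Filter.Eventually.and (e.open_target.mem_nhds (e.map_source hpe)) ?_
    have hc := e.symm.continuousAt (e.map_source hpe)
    rw [ContinuousAt, e.left_inv hpe] at hc
    exact hc.eventually ev
  obtain ⟨r, hr, hball⟩ := Metric.eventually_nhds_iff_ball.1 ev'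
  set B := Metric.ball (e p) r
  have hsymm : ∀ x ∈ e.source, e x ∈ B → (x ∈ F.U i ∧ x ∈ U) ∧
      G.g x (coordField e ξ x) (coordField e ξ x) < 0 ∧ G.g x (coordField e ξ x) (X x) < 0 := by
    intro x hx hxB
    have := (hball _ hxB).2
    rwa [e.left_inv hx] at this
  have hwedge : ∀ x ∈ e.source, e x ∈ B → coordField e ξ x ∈ T.wedge x := fun x hx hxB =>
    (T.mem_wedge_iff (hXW x (hsymm x hx hxB).1.2) _).2 (hsymm x hx hxB).2
  have hker : ∀ u ∈ B, ∀ z, P z = 0 → coordField e z (e.symm u) ∈ F.tangent (e.symm u) := by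
    intro u hu z hz
    obtain ⟨ht, ⟨hi, -⟩, -⟩ := hball u hu
    refine coordField_mem_tangent he (e.map_target ht) hi ?_
    rw [e.right_inv ht]
    have hcont : ContinuousAt (fun s : ℝ => u + s • z) 0 := by fun_prop
    have hev : ∀ᶠ s in 𝓝 (0 : ℝ), u + s • z ∈ e.target :=
      hcont (e.open_target.mem_nhds (by simpa using ht))
    filter_upwards [hev] with s hs'
    have h1 := e.map_target hs'
    have h2 := e.map_target ht
    -- The normal form gives equality only after the chart of the target; injectivity of that chart
    -- makes `proj i` itself constant along `ker P`.
    refine hs.codChart.injOn (hcod _ h1) (hcod _ h2) ?_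
    rw [hP _ h1, hP _ h2, e.right_inv hs', e.right_inv ht]
    simp [hz]
  exact ⟨{
    e := e
    B := B
    P := P
    h := coordForm G e
    ξ := ξ
    strict := {
      mem_atlas := he
      isOpen := Metric.isOpen_ball
      convex := convex_ball _ _
      subset := fun u hu => (hball u hu).1
      mem_iff := fun x hx hxB v => by
        refine (T.mem_wedge_iff (hwedge x hx hxB) v).trans ?_
        rw [← coordForm_mfderiv G he hx v v, ← coordForm_mfderiv_right G he hx v ξ]
        rfl }
    weak := {
      mem_atlas := he
      isOpen := Metric.isOpen_ball
      convex := convex_ball _ _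
      subset := fun u hu => (hball u hu).1
      mem_iff := fun x hx hxB v => by
        refine (T.mem_causalWedge_iff (hwedge x hx hxB) v).trans ?_
        rw [← coordForm_mfderiv G he hx v v, ← coordForm_mfderiv_right G he hx v ξ]
        rfl }
    mem_source := hpe
    mem_B := Metric.mem_ball_self hr
    contDiffOn := (contDiffOn_coordForm G he).mono fun u hu => (hball u hu).1
    symm := fun u _ v w => G.symm _ _ _
    timelike := fun u hu => (hball u hu).2.2.1
    h_congr := fun u hu u' hu' huu => by
      have hz : P (u - u') = 0 := by rw [map_sub, huu, sub_self]
      have := coordForm_eq_of_segment G he Metric.isOpen_ball (convex_ball _ _)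
        (fun u hu => (hball u hu).1) (fun u hu => hker u hu _ hz) hu'
        (by rwa [add_sub_cancel])
      rwa [add_sub_cancel] at this
    h_ker := fun u hu z hz => by
      ext w
      exact G.basic.left _ _ (hker u hu z hz) _
    proj := fun x hx x' hx' _ _ h => by rw [← hP x hx, ← hP x' hx', h] }⟩

end LorentzFoliation
end

/-! ### Passage to the leaf space and conclusion. -/

noncomputable section

namespace LorentzFoliation

/-- Closures, interiors and frontiers of futures, for an open relation `R` and a coarser relation
`S` that satisfies the push-up property. -/
theorem closure_interior_frontier_future {X : Type*} [TopologicalSpace X] {R S : X → X → Prop}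
    (hRS : ∀ a b, R a b → S a b) (hpush : ∀ a b c, S a b → R b c → R a c)
    (hopen : ∀ a, IsOpen {b | R a b}) (hfut : ∀ a, a ∈ closure {b | R a b})
    (hpast : ∀ a, a ∈ closure {b | R b a}) (A : Set X) :
    closure {b | ∃ a ∈ A, S a b} = closure {b | ∃ a ∈ A, R a b} ∧
      interior {b | ∃ a ∈ A, S a b} = {b | ∃ a ∈ A, R a b} ∧
      frontier {b | ∃ a ∈ A, S a b} = frontier {b | ∃ a ∈ A, R a b} := by
  have hsub : {b | ∃ a ∈ A, R a b} ⊆ {b | ∃ a ∈ A, S a b} := by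
    rintro b ⟨a, ha, hab⟩
    exact ⟨a, ha, hRS a b hab⟩
  have hop : IsOpen {b | ∃ a ∈ A, R a b} := by
    have : {b | ∃ a ∈ A, R a b} = ⋃ a ∈ A, {b | R a b} := by ext b; simp
    rw [this]
    exact isOpen_biUnion fun a _ => hopen a
  have hcl : closure {b | ∃ a ∈ A, S a b} = closure {b | ∃ a ∈ A, R a b} := by
    refine (closure_minimal ?_ isClosed_closure).antisymm (closure_mono hsub)
    rintro b ⟨a, ha, hab⟩
    -- The future of `b` lies in that of `A` by push-up, and `b` is a limit of its own future.
    have hb : {c | R b c} ⊆ {c | ∃ a ∈ A, R a c} := fun c hbc => ⟨a, ha, hpush a b c hab hbc⟩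
    exact closure_mono hb (hfut b)
  have hint : interior {b | ∃ a ∈ A, S a b} = {b | ∃ a ∈ A, R a b} := by
    refine Subset.antisymm (fun b hb => ?_) (interior_maximal hsub hop)
    -- An interior point `b` has an `R`-predecessor `c` still in the `S`-future of `A`; push-up then
    -- gives a strict relation to `b`.
    obtain ⟨c, hc, hcb⟩ := mem_closure_iff.1 (hpast b) _ isOpen_interior hb
    obtain ⟨a, ha, hac⟩ := interior_subset hc
    exact ⟨a, ha, hpush a c b hac hcb⟩
  exact ⟨hcl, hint, by rw [frontier, frontier, hcl, hint, hop.interior_eq]⟩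

namespace TimeOrientation

variable {ι : Type*} {n q : ℕ} {M : Type*} [TopologicalSpace M]
  [ChartedSpace (EuclideanSpace ℝ (Fin n)) M] [IsManifold (𝓡 n) ∞ M]
  {F : Foliation ι n q M} {G : TransverseLorentzMetric F} (T : TimeOrientation G)

/-- Any representatives may be used, so curves that meet only in a common leaf can be joined as if
they met in a point. -/
theorem chron_leaf_iff (x y : M) : T.Chron (F.leaf x) (F.leaf y) ↔ Reach T.wedge x y := by
  constructor
  · rintro ⟨α, a, b, hab, hα, ha, hb⟩
    exact (T.hasLocalModels.reach_strict_iff_of_leaf_eq ha hb).1 (hα.reach hab)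
  · intro h
    obtain ⟨α, a, b, hab, hα, rfl, rfl⟩ := reach_iff_exists_isPiecewiseSmoothIn.1 h
    exact ⟨α, a, b, hab, hα, rfl, rfl⟩

theorem causalLT_leaf_iff (x y : M) :
    T.CausalLT (F.leaf x) (F.leaf y) ↔ Reach T.causalWedge x y := by
  constructor
  · rintro ⟨α, a, b, hab, hα, ha, hb⟩
    exact (T.hasLocalModels.reach_weak_iff_of_leaf_eq ha hb).1 (hα.reach hab)
  · intro h
    obtain ⟨α, a, b, hab, hα, rfl, rfl⟩ := reach_iff_exists_isPiecewiseSmoothIn.1 h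
    exact ⟨α, a, b, hab, hα, rfl, rfl⟩

theorem exists_leaf_eq (L : F.LeafSpace) : ∃ x, F.leaf x = L := Quotient.exists_rep L

variable {T} {L₁ L₂ L₃ L L' : F.LeafSpace}

theorem Chron.trans (h : T.Chron L₁ L₂) (h' : T.Chron L₂ L₃) : T.Chron L₁ L₃ := by
  obtain ⟨x, rfl⟩ := exists_leaf_eq L₁
  obtain ⟨y, rfl⟩ := exists_leaf_eq L₂
  obtain ⟨z, rfl⟩ := exists_leaf_eq L₃
  rw [chron_leaf_iff] at *
  exact Relation.TransGen.trans h h'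

theorem CausalLT.trans (h : T.CausalLT L₁ L₂) (h' : T.CausalLT L₂ L₃) : T.CausalLT L₁ L₃ := by
  obtain ⟨x, rfl⟩ := exists_leaf_eq L₁
  obtain ⟨y, rfl⟩ := exists_leaf_eq L₂
  obtain ⟨z, rfl⟩ := exists_leaf_eq L₃
  rw [causalLT_leaf_iff] at *
  exact Relation.TransGen.trans h h'

theorem Chron.exists_between (h : T.Chron L L') : ∃ L'', T.Chron L L'' ∧ T.Chron L'' L' := by
  obtain ⟨x, rfl⟩ := exists_leaf_eq L
  obtain ⟨y, rfl⟩ := exists_leaf_eq L'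
  obtain ⟨z, h₁, h₂⟩ := ((T.chron_leaf_iff x y).1 h).split
  exact ⟨F.leaf z, (T.chron_leaf_iff x z).2 h₁, (T.chron_leaf_iff z y).2 h₂⟩

theorem CausalLT.exists_between (h : T.CausalLT L L') :
    ∃ L'', T.CausalLT L L'' ∧ T.CausalLT L'' L' := by
  obtain ⟨x, rfl⟩ := exists_leaf_eq L
  obtain ⟨y, rfl⟩ := exists_leaf_eq L'
  obtain ⟨z, h₁, h₂⟩ := ((T.causalLT_leaf_iff x y).1 h).split
  exact ⟨F.leaf z, (T.causalLT_leaf_iff x z).2 h₁, (T.causalLT_leaf_iff z y).2 h₂⟩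

theorem Chron.causalLT (h : T.Chron L L') : T.CausalLT L L' := by
  obtain ⟨x, rfl⟩ := exists_leaf_eq L
  obtain ⟨y, rfl⟩ := exists_leaf_eq L'
  rw [causalLT_leaf_iff]
  exact ((T.chron_leaf_iff x y).1 h).mono T.wedge_subset_causalWedge

theorem Chron.trans_causalLE (h : T.Chron L₁ L₂) (h' : T.CausalLE L₂ L₃) : T.Chron L₁ L₃ := by
  rcases h' with h' | rfl
  · obtain ⟨x, rfl⟩ := exists_leaf_eq L₁
    obtain ⟨y, rfl⟩ := exists_leaf_eq L₂
    obtain ⟨z, rfl⟩ := exists_leaf_eq L₃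
    rw [chron_leaf_iff] at *
    exact T.hasLocalModels.reach_of_reach h ((T.causalLT_leaf_iff y z).1 h')
  · exact h

theorem CausalLE.trans_chron (h : T.CausalLE L₁ L₂) (h' : T.Chron L₂ L₃) : T.Chron L₁ L₃ := by
  rcases h with h | rfl
  · obtain ⟨x, rfl⟩ := exists_leaf_eq L₁
    obtain ⟨y, rfl⟩ := exists_leaf_eq L₂
    obtain ⟨z, rfl⟩ := exists_leaf_eq L₃
    rw [chron_leaf_iff, ← reach_reverse_iff] at *
    rw [causalLT_leaf_iff, ← reach_reverse_iff] at h
    exact T.hasLocalModels.reverse.reach_of_reach h' h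
  · exact h'

variable (T)

theorem isOpen_setOf_chron (L : F.LeafSpace) : IsOpen {L' | T.Chron L L'} := by
  obtain ⟨x, rfl⟩ := exists_leaf_eq L
  rw [← isQuotientMap_quotient_mk'.isOpen_preimage]
  convert T.hasLocalModels.isOpen_setOf_reach x using 1
  ext y
  exact T.chron_leaf_iff x y

theorem isOpen_setOf_chron_left (L : F.LeafSpace) : IsOpen {L' | T.Chron L' L} := by
  obtain ⟨x, rfl⟩ := exists_leaf_eq L
  rw [← isQuotientMap_quotient_mk'.isOpen_preimage]
  convert T.hasLocalModels.reverse.isOpen_setOf_reach x using 1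
  ext y
  exact (T.chron_leaf_iff y x).trans reach_reverse_iff.symm

theorem continuous_leaf : Continuous F.leaf := continuous_quotient_mk'

theorem mem_closure_setOf_chron (L : F.LeafSpace) : L ∈ closure {L' | T.Chron L L'} := by
  obtain ⟨x, rfl⟩ := exists_leaf_eq L
  exact map_mem_closure continuous_leaf (T.hasLocalModels.mem_closure_setOf_seg x)
    fun y hy => (T.chron_leaf_iff x y).2 hy.reach

theorem mem_closure_setOf_chron_left (L : F.LeafSpace) : L ∈ closure {L' | T.Chron L' L} := by
  obtain ⟨x, rfl⟩ := exists_leaf_eq L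
  exact map_mem_closure continuous_leaf (T.hasLocalModels.reverse.mem_closure_setOf_seg x)
    fun y hy => (T.chron_leaf_iff y x).2 (seg_reverse_iff.1 hy).reach

/-- An intermediate leaf `L''` gives the open rectangle of its past times its future, inside the
relation by transitivity. Working with rectangles yields openness directly in the product of the
quotient topologies. -/
theorem isOpen_chron : IsOpen {p : F.LeafSpace × F.LeafSpace | T.Chron p.1 p.2} := by
  rw [isOpen_iff_mem_nhds]
  rintro ⟨L, L'⟩ h
  obtain ⟨L'', h₁, h₂⟩ := Chron.exists_between h
  filter_upwards [prod_mem_nhds ((T.isOpen_setOf_chron_left L'').mem_nhds h₁)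
    ((T.isOpen_setOf_chron L'').mem_nhds h₂)] with p hp
  exact Chron.trans hp.1 hp.2

end TimeOrientation

end LorentzFoliation
end

open LorentzFoliation in
theorem theorem4p23 {ι : Type*} {n q : ℕ} (hq : 2 ≤ q) (hqn : q < n)
    {M : Type*} [TopologicalSpace M] [T2Space M] [SecondCountableTopology M] [ConnectedSpace M]
    [ChartedSpace (EuclideanSpace ℝ (Fin n)) M] [IsManifold (𝓡 n) ∞ M]
    (F : Foliation ι n q M) (G : TransverseLorentzMetric F) (T : TimeOrientation G) :
    -- transitivity
    ((∀ L₁ L₂ L₃ : F.LeafSpace, T.Chron L₁ L₂ → T.Chron L₂ L₃ → T.Chron L₁ L₃) ∧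
      (∀ L₁ L₂ L₃ : F.LeafSpace, T.CausalLT L₁ L₂ → T.CausalLT L₂ L₃ → T.CausalLT L₁ L₃)) ∧
    -- density
    ((∀ L L' : F.LeafSpace, T.Chron L L' → ∃ L'', T.Chron L L'' ∧ T.Chron L'' L') ∧
      (∀ L L' : F.LeafSpace, T.CausalLT L L' → ∃ L'', T.CausalLT L L'' ∧ T.CausalLT L'' L')) ∧
    -- futures and pasts of a leaf are non-empty
    (∀ L : F.LeafSpace, (T.chronFuture {L}).Nonempty ∧ (T.chronPast {L}).Nonempty ∧
      (T.causalFuture {L}).Nonempty ∧ (T.causalPast {L}).Nonempty) ∧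
    -- openness of chronology
    IsOpen {p : F.LeafSpace × F.LeafSpace | T.Chron p.1 p.2} ∧
    -- push-up property
    (∀ L₁ L₂ L₃ : F.LeafSpace,
      (T.Chron L₁ L₂ ∧ T.CausalLE L₂ L₃) ∨ (T.CausalLE L₁ L₂ ∧ T.Chron L₂ L₃) →
        T.Chron L₁ L₃) ∧
    -- closures, interiors and boundaries of futures and pasts
    (∀ A : Set F.LeafSpace,
      (closure (T.causalFuture A) = closure (T.chronFuture A) ∧
        closure (T.causalPast A) = closure (T.chronPast A)) ∧
      (interior (T.causalFuture A) = T.chronFuture A ∧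
        interior (T.causalPast A) = T.chronPast A) ∧
      (frontier (T.causalFuture A) = frontier (T.chronFuture A) ∧
        frontier (T.causalPast A) = frontier (T.chronPast A))) := by
  refine ⟨⟨fun _ _ _ => .trans, fun _ _ _ => .trans⟩,
    ⟨fun _ _ h => h.exists_between, fun _ _ h => h.exists_between⟩, fun L => ?_, T.isOpen_chron,
    fun L₁ L₂ L₃ h => h.elim (fun h => h.1.trans_causalLE h.2) (fun h => h.1.trans_chron h.2),
    fun A => ?_⟩
  · obtain ⟨L₁, h₁⟩ := closure_nonempty_iff.1 ⟨L, T.mem_closure_setOf_chron L⟩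
    obtain ⟨L₂, h₂⟩ := closure_nonempty_iff.1 ⟨L, T.mem_closure_setOf_chron_left L⟩
    exact ⟨⟨L₁, L, rfl, h₁⟩, ⟨L₂, L, rfl, h₂⟩, ⟨L₁, L, rfl, .inl h₁.causalLT⟩,
      ⟨L₂, L, rfl, .inl h₂.causalLT⟩⟩
  · obtain ⟨c₁, i₁, f₁⟩ := closure_interior_frontier_future (R := T.Chron) (S := T.CausalLE)
      (fun _ _ h => .inl h.causalLT) (fun _ _ _ h h' => h.trans_chron h') T.isOpen_setOf_chron
      T.mem_closure_setOf_chron T.mem_closure_setOf_chron_left A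
    -- Pasts are futures for the opposite relations, for which the other half of push-up is the one
    -- required.
    obtain ⟨c₂, i₂, f₂⟩ := closure_interior_frontier_future (R := fun L L' => T.Chron L' L)
      (S := fun L L' => T.CausalLE L' L) (fun _ _ h => .inl h.causalLT)
      (fun _ _ _ h h' => h'.trans_causalLE h) T.isOpen_setOf_chron_left
      T.mem_closure_setOf_chron_left T.mem_closure_setOf_chron A
    exact ⟨⟨c₁, c₂⟩, ⟨i₁, i₂⟩, ⟨f₁, f₂⟩⟩
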